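/- **Robust multi-period ordering with predictions under changing costs (RMOwP).** An instance $\mathcal V$ consists of integers $T,K\ge 1$; a grid $1=\tau_0<\tau_1<\dots<\tau_K=T+1$ dividing the preparation days $1,\dots,T$ into $K$ phases, phase $v$ being $\{\tau_{v-1},\dots,\tau_v-1\}$; an initial demand range $[\underline d_0,\overline d_0]$ with $\underline d_0\ge 0$; prediction error bounds $\overline d_0-\underline d_0\ge\triangle_1\ge\triangle_2\ge\dots\ge\triangle_T\ge 0$; a unit revenue $p$; unit ordering costs $\gamma_1,\dots,\gamma_K$, where $c_t=\gamma_v$ for every day $t$ of phase $v$; and capacities $V_1,\dots,V_T\ge 0$. A prediction sequence $\mathcal P=(\mathcal P_t)_{t=1}^T$, $\mathcal P_t=[\underline d_t,\overline d_t]$, is regular if $\mathcal P_t\subseteq\mathcal P_{t-1}$ (with $\mathcal P_0=[\underline d_0,\overline d_0]$) and $0\le\overline d_t-\underline d_t\le\triangle_t$ for all $t\in\{1,\dots,T\}$. A policy $\pi=(\pi_1,\dots,\pi_T)$ consists of maps $\pi_t:\{[a,b]:0\le b-a\le\triangle_t\}\times\mathbb R^K\to[0,V_t]$. Starting from $\mathbf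 x_1=\mathbf 0\in\mathbb R^K$, on day $t$ of phase $v$ it orders $a_t=\pi_t(\mathcal P_t,\mathbf x_t)$ and $\mathbf x_{t+1}=\mathbf x_t+a_t\mathbf e_v$. If the demand is $d\in\mathcal P_T$, the profit is $\mathcal R_\pi(\mathcal P,d)=p\min\{d,\sum_{t=1}^T a_t\}-\sum_{t=1}^T c_ta_t$, and the optimal profit in hindsight is $\mathcal R^\sharp(d)=\sum_{t=1}^T(p-c_t)\min\{V_t,\max\{d-\sum_{i<t}V_i,0\}\}$. Put $\varphi_\pi(\mathcal P,d)=\mathcal R_\pi(\mathcal P,d)/\mathcal R^\sharp(d)$, where, if $\mathcal R^\sharp(d)=0$, the ratio is read as $1$ when $\mathcal R_\pi(\mathcal P,d)\ge 0$ and as $-\infty$ otherwise. The robust competitive ratio $\varphi_\pi(\mathcal V)$ is the infimum of $\varphi_\pi(\mathcal P,d)$ over all regular $\mathcal P$ and $d\in\mathcal P_T$; $\tilde\varphi_\pi(\mathcal V)$ is the infimum over those pairs for which moreover $\overline d_t-\underline d_t=\triangle_t$ for all $t\in\{1,\dots,T\}$. **Proposition.** There are a real-RAM program $A$ (unit-cost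 real arithmetic and comparisons, unit-cost addition, subtraction and comparison of natural numbers, indirect addressing, no rounding), a real-RAM program $B$ and a constant $C$, all independent of the instance, such that the following holds for every instance $\mathcal V$ with $0<\gamma_1<\dots<\gamma_K<p$ and every real $\Phi\le 1$. 1. On input $(\mathcal V,\Phi)$, program $A$ halts after at most $C\,T^{CK}=T^{O(K)}$ steps and decides correctly whether $\sup_\pi\tilde\varphi_\pi(\mathcal V)\ge\Phi$ and, equivalently, whether $\sup_\pi\varphi_\pi(\mathcal V)\ge\Phi$. 2. If the answer is yes, there is a policy $\pi$ with $\varphi_\pi(\mathcal V)\ge\Phi$ (hence also $\tilde\varphi_\pi(\mathcal V)\ge\Phi$) that $B$ computes online: started from the final memory of $A$ with the day $t\in\{1,\dots,T\}$, the current interval $[a,b]$ (with $0\le b-a\le\triangle_t$) and any vector $\mathbf x\in\mathbb R^K$ written into its first cells, $B$ returns $\pi_t([a,b],\mathbf x)$ after at most $C\,T^{CK}$ steps. -/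

import Mathlib

/-! ### The model of computation: a real RAM

Memory consists of two arrays, one of natural numbers (counters and addresses) and one of real
numbers.  A program is a finite piece of text of a structured language, its only numerical
constants are natural and rational literals.  Every elementary operation (reading or writing a
cell, indirect addressing, addition and truncated subtraction of natural numbers, `+ - * /` of
real numbers, a comparison) has unit cost; there is no rounding and no conversion of real numbers
into natural numbers. -/
namespace RealRAM

/-- A memory state. -/
structure Mem where
  nat : ℕ → ℕ
  real : ℕ → ℝ

/-- Expressions with values in `ℕ`; `get a` reads the natural-number cell with address `a`. -/
inductive NExp where
  | lit (n : ℕ)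
  | get (a : NExp)
  | add (a b : NExp)
  | sub (a b : NExp)

/-- Expressions with values in `ℝ`; `get a` reads the real cell with address `a`. -/
inductive RExp where
  | lit (q : ℚ)
  | get (a : NExp)
  | add (a b : RExp)
  | sub (a b : RExp)
  | mul (a b : RExp)
  | div (a b : RExp)

/-- Tests. -/
inductive BExp where
  | natLE (a b : NExp)
  | realLE (a b : RExp)
  | neg (b : BExp)
  | both (b c : BExp)

/-- Programs: assignment to a natural-number cell or to a real cell (the first argument is the
address), sequential composition, conditional, loop. -/
inductive Cmd where
  | skip
  | natSet (a e : NExp)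
  | realSet (a : NExp) (e : RExp)
  | seq (c₁ c₂ : Cmd)
  | ite (b : BExp) (c₁ c₂ : Cmd)
  | loop (b : BExp) (c : Cmd)

/-- Value of a natural-number expression. -/
def NExp.eval (σ : Mem) : NExp → ℕ
  | .lit n => n
  | .get a => σ.nat (a.eval σ)
  | .add a b => a.eval σ + b.eval σ
  | .sub a b => a.eval σ - b.eval σ

/-- Number of elementary operations in the evaluation of a natural-number expression. -/
def NExp.cost : NExp → ℕ
  | .lit _ => 1
  | .get a => a.cost + 1
  | .add a b => a.cost + b.cost + 1
  | .sub a b => a.cost + b.cost + 1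

/-- Value of a real expression (a division by zero returns zero). -/
noncomputable def RExp.eval (σ : Mem) : RExp → ℝ
  | .lit q => (q : ℝ)
  | .get a => σ.real (a.eval σ)
  | .add a b => a.eval σ + b.eval σ
  | .sub a b => a.eval σ - b.eval σ
  | .mul a b => a.eval σ * b.eval σ
  | .div a b => a.eval σ / b.eval σ

/-- Number of elementary operations in the evaluation of a real expression. -/
def RExp.cost : RExp → ℕ
  | .lit _ => 1
  | .get a => a.cost + 1
  | .add a b => a.cost + b.cost + 1
  | .sub a b => a.cost + b.cost + 1
  | .mul a b => a.cost + b.cost + 1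
  | .div a b => a.cost + b.cost + 1

/-- Truth of a test. -/
def BExp.eval (σ : Mem) : BExp → Prop
  | .natLE a b => a.eval σ ≤ b.eval σ
  | .realLE a b => a.eval σ ≤ b.eval σ
  | .neg b => ¬ b.eval σ
  | .both b c => b.eval σ ∧ c.eval σ

/-- Number of elementary operations in a test. -/
def BExp.cost : BExp → ℕ
  | .natLE a b => a.cost + b.cost + 1
  | .realLE a b => a.cost + b.cost + 1
  | .neg b => b.cost + 1
  | .both b c => b.cost + c.cost + 1

/-- `Exec c σ σ' n`: started in memory `σ`, the program `c` halts in memory `σ'` after exactly `n`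
elementary operations. -/
inductive Exec : Cmd → Mem → Mem → ℕ → Prop
  | skip (σ : Mem) : Exec .skip σ σ 1
  | natSet (a e : NExp) (σ : Mem) :
      Exec (.natSet a e) σ ⟨Function.update σ.nat (a.eval σ) (e.eval σ), σ.real⟩
        (a.cost + e.cost + 1)
  | realSet (a : NExp) (e : RExp) (σ : Mem) :
      Exec (.realSet a e) σ ⟨σ.nat, Function.update σ.real (a.eval σ) (e.eval σ)⟩
        (a.cost + e.cost + 1)
  | seq {c₁ c₂ : Cmd} {σ σ' σ'' : Mem} {n m : ℕ} :
      Exec c₁ σ σ' n → Exec c₂ σ' σ'' m → Exec (.seq c₁ c₂) σ σ'' (n + m)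
  | iteTrue {b : BExp} {c₁ c₂ : Cmd} {σ σ' : Mem} {n : ℕ} :
      b.eval σ → Exec c₁ σ σ' n → Exec (.ite b c₁ c₂) σ σ' (b.cost + n + 1)
  | iteFalse {b : BExp} {c₁ c₂ : Cmd} {σ σ' : Mem} {n : ℕ} :
      ¬ b.eval σ → Exec c₂ σ σ' n → Exec (.ite b c₁ c₂) σ σ' (b.cost + n + 1)
  | loopStop {b : BExp} {c : Cmd} {σ : Mem} :
      ¬ b.eval σ → Exec (.loop b c) σ σ (b.cost + 1)
  | loopStep {b : BExp} {c : Cmd} {σ σ' σ'' : Mem} {n m : ℕ} :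
      b.eval σ → Exec c σ σ' n → Exec (.loop b c) σ' σ'' m →
      Exec (.loop b c) σ σ'' (b.cost + n + m + 1)

/-- Execution is deterministic: result and running time are determined by program and input. -/
theorem Exec.det {c : Cmd} {σ σ₁ : Mem} {n₁ : ℕ} (h₁ : Exec c σ σ₁ n₁) :
    ∀ {σ₂ : Mem} {n₂ : ℕ}, Exec c σ σ₂ n₂ → σ₁ = σ₂ ∧ n₁ = n₂ := by
  induction h₁ with
  | skip => intro _ _ h; cases h; exact ⟨rfl, rfl⟩
  | natSet => intro _ _ h; cases h; exact ⟨rfl, rfl⟩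
  | realSet => intro _ _ h; cases h; exact ⟨rfl, rfl⟩
  | seq _ _ ih₁ ih₂ =>
    intro _ _ h
    cases h with
    | seq k₁ k₂ =>
      obtain ⟨rfl, rfl⟩ := ih₁ k₁
      obtain ⟨rfl, rfl⟩ := ih₂ k₂
      exact ⟨rfl, rfl⟩
  | iteTrue hb _ ih =>
    intro _ _ h
    cases h with
    | iteTrue _ k => obtain ⟨rfl, rfl⟩ := ih k; exact ⟨rfl, rfl⟩
    | iteFalse hb' _ => exact absurd hb hb'
  | iteFalse hb _ ih =>
    intro _ _ h
    cases h with
    | iteTrue hb' _ => exact absurd hb' hb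
    | iteFalse _ k => obtain ⟨rfl, rfl⟩ := ih k; exact ⟨rfl, rfl⟩
  | loopStop hb =>
    intro _ _ h
    cases h with
    | loopStop _ => exact ⟨rfl, rfl⟩
    | loopStep hb' _ _ => exact absurd hb' hb
  | loopStep hb _ _ ih₁ ih₂ =>
    intro _ _ h
    cases h with
    | loopStop hb' => exact absurd hb hb'
    | loopStep _ k₁ k₂ =>
      obtain ⟨rfl, rfl⟩ := ih₁ k₁
      obtain ⟨rfl, rfl⟩ := ih₂ k₂
      exact ⟨rfl, rfl⟩

/-- The memory `σ` after a query has been written over its first cells: the number `t` into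
natural-number cell `0`, the end points of `I` into real cells `0` and `1`, the vector `x` into
real cells `2, …, K + 1`. -/
noncomputable def Mem.query {K : ℕ} (σ : Mem) (t : ℕ) (I : ℝ × ℝ) (x : Fin K → ℝ) : Mem where
  nat := Function.update σ.nat 0 t
  real := fun i =>
    if i = 0 then I.1 else if i = 1 then I.2
    else if h : i - 2 < K then x ⟨i - 2, h⟩ else σ.real i

end RealRAM

/-! ### Robust multi-period ordering with predictions under changing costs -/

/-- An instance: preparation days `1, …, T`, divided into `K` cost phases by the grid `τ` (the phase
with index `v : Fin K` consists of the days `t` with `τ v ≤ t < τ (v + 1)`), initial demand range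
`[dlo, dhi]`, prediction error upper bounds `Δ t`, unit ordering cost `γ v` in phase `v`, unit
revenue `p`, supply capacity `V t` on day `t`.  The values of `Δ` and `V` outside `1, …, T` have no
meaning and are never used. -/
structure RMOwP where
  T : ℕ
  K : ℕ
  τ : Fin (K + 1) → ℕ
  dlo : ℝ
  dhi : ℝ
  Δ : ℕ → ℝ
  γ : Fin K → ℝ
  p : ℝ
  V : ℕ → ℝ
  one_le_T : 1 ≤ T
  τ_strictMono : StrictMono τ
  τ_zero : τ 0 = 1
  τ_last : τ (Fin.last K) = T + 1
  dlo_nonneg : 0 ≤ dlo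
  Δ_nonneg : ∀ t, 1 ≤ t → t ≤ T → 0 ≤ Δ t
  Δ_anti : ∀ t, 1 ≤ t → t < T → Δ (t + 1) ≤ Δ t
  Δ_one_le : Δ 1 ≤ dhi - dlo
  γ_pos : ∀ v, 0 < γ v
  γ_mono : Monotone γ
  γ_lt_p : ∀ v, γ v < p
  V_nonneg : ∀ t, 1 ≤ t → t ≤ T → 0 ≤ V t

namespace RMOwP

/-- Day `t` belongs to phase `v`. -/
def InPhase (𝒱 : RMOwP) (v : Fin 𝒱.K) (t : ℕ) : Prop :=
  𝒱.τ v.castSucc ≤ t ∧ t < 𝒱.τ v.succ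

instance (𝒱 : RMOwP) (v : Fin 𝒱.K) (t : ℕ) : Decidable (𝒱.InPhase v t) :=
  inferInstanceAs (Decidable (_ ∧ _))

/-- The unit ordering cost on day `t`: it is `γ v` for the phase `v` that contains `t`. -/
noncomputable def cost (𝒱 : RMOwP) (t : ℕ) : ℝ :=
  ∑ v : Fin 𝒱.K, if 𝒱.InPhase v t then 𝒱.γ v else 0

/-- A family of maps that on day `t` sends the current prediction interval (given by its two end
points) and the inventory vector (amount ordered so far in each phase) to an order quantity. -/
abbrev Policy (𝒱 : RMOwP) : Type := ℕ → ℝ × ℝ → (Fin 𝒱.K → ℝ) → ℝ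

/-- `π t` maps `{[a, b] : 0 ≤ b - a ≤ Δ t} × ℝ^K` into `[0, V t]` on each day `t ∈ {1, …, T}`. -/
def IsFeasible (𝒱 : RMOwP) (π : 𝒱.Policy) : Prop :=
  ∀ t, 1 ≤ t → t ≤ 𝒱.T → ∀ I : ℝ × ℝ, 0 ≤ I.2 - I.1 → I.2 - I.1 ≤ 𝒱.Δ t →
    ∀ x : Fin 𝒱.K → ℝ, 0 ≤ π t I x ∧ π t I x ≤ 𝒱.V t

/-- `P 1, …, P T` is a regular prediction sequence; `P 0` stands for `[dlo, dhi]`. -/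
structure IsRegular (𝒱 : RMOwP) (P : ℕ → ℝ × ℝ) : Prop where
  start : P 0 = (𝒱.dlo, 𝒱.dhi)
  le : ∀ t, 1 ≤ t → t ≤ 𝒱.T → (P t).1 ≤ (P t).2
  nested : ∀ t, t < 𝒱.T → (P t).1 ≤ (P (t + 1)).1 ∧ (P (t + 1)).2 ≤ (P t).2
  error : ∀ t, 1 ≤ t → t ≤ 𝒱.T → (P t).2 - (P t).1 ≤ 𝒱.Δ t

/-- The inventory vector before the order of day `t` under policy `π` and predictions `P`.  It is
zero up to day `1` (day `0` lies in no phase), and the order of day `t` is added to the coordinate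
of the phase that contains `t`. -/
noncomputable def inventory (𝒱 : RMOwP) (π : 𝒱.Policy) (P : ℕ → ℝ × ℝ) : ℕ → Fin 𝒱.K → ℝ
  | 0 => 0
  | t + 1 => fun v => 𝒱.inventory π P t v +
      if 𝒱.InPhase v t then π t (P t) (𝒱.inventory π P t) else 0

/-- The order of day `t` under policy `π` and predictions `P`. -/
noncomputable def order (𝒱 : RMOwP) (π : 𝒱.Policy) (P : ℕ → ℝ × ℝ) (t : ℕ) : ℝ :=
  π t (P t) (𝒱.inventory π P t)

/-- The profit of the order quantities `a 1, …, a T` when the demand is `d`: revenue minus total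
ordering cost. -/
noncomputable def planProfit (𝒱 : RMOwP) (a : ℕ → ℝ) (d : ℝ) : ℝ :=
  𝒱.p * min d (∑ t ∈ Finset.Icc 1 𝒱.T, a t) - ∑ t ∈ Finset.Icc 1 𝒱.T, 𝒱.cost t * a t

/-- The profit of policy `π` under predictions `P` and demand `d`. -/
noncomputable def profit (𝒱 : RMOwP) (π : 𝒱.Policy) (P : ℕ → ℝ × ℝ) (d : ℝ) : ℝ :=
  𝒱.planProfit (𝒱.order π P) d

/-- The hindsight optimal profit for demand `d` (`isGreatest_hindsight` below shows that it is the
largest profit of any order plan that respects the capacities). -/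
noncomputable def hindsight (𝒱 : RMOwP) (d : ℝ) : ℝ :=
  ∑ t ∈ Finset.Icc 1 𝒱.T,
    (𝒱.p - 𝒱.cost t) * min (𝒱.V t) (max (d - ∑ i ∈ Finset.Ico 1 t, 𝒱.V i) 0)

/-- Every preparation day lies in some phase. -/
theorem exists_inPhase (𝒱 : RMOwP) {t : ℕ} (h₁ : 1 ≤ t) (h₂ : t ≤ 𝒱.T) :
    ∃ v, 𝒱.InPhase v t := by
  by_contra hno
  have key : ∀ i : Fin (𝒱.K + 1), 𝒱.τ i ≤ t := by
    intro i
    induction i using Fin.induction with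
    | zero => rw [𝒱.τ_zero]; exact h₁
    | succ v ih =>
      by_contra hlt
      exact hno ⟨v, ih, not_le.mp hlt⟩
  have := key (Fin.last 𝒱.K)
  rw [𝒱.τ_last] at this
  omega

/-- The ordering cost of a day is the cost of its phase. -/
theorem cost_eq (𝒱 : RMOwP) {t : ℕ} {v : Fin 𝒱.K} (h : 𝒱.InPhase v t) : 𝒱.cost t = 𝒱.γ v := by
  unfold cost
  rw [Finset.sum_eq_single v]
  · rw [if_pos h]
  · intro w _ hw
    rw [if_neg]
    intro hw'
    rcases lt_or_gt_of_ne hw with hlt | hlt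
    · have := 𝒱.τ_strictMono.monotone (show w.succ ≤ v.castSucc from hlt)
      have h1 := h.1
      have h2 := hw'.2
      omega
    · have := 𝒱.τ_strictMono.monotone (show v.succ ≤ w.castSucc from hlt)
      have h1 := h.2
      have h2 := hw'.1
      omega
  · intro hv; exact absurd (Finset.mem_univ v) hv

theorem cost_mono (𝒱 : RMOwP) {s t : ℕ} (h₁ : 1 ≤ s) (hst : s ≤ t) (h₂ : t ≤ 𝒱.T) :
    𝒱.cost s ≤ 𝒱.cost t := by
  obtain ⟨v, hv⟩ := 𝒱.exists_inPhase h₁ (hst.trans h₂)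
  obtain ⟨w, hw⟩ := 𝒱.exists_inPhase (h₁.trans hst) h₂
  rw [𝒱.cost_eq hv, 𝒱.cost_eq hw]
  apply 𝒱.γ_mono
  by_contra hlt
  have := 𝒱.τ_strictMono.monotone (show w.succ ≤ v.castSucc from not_le.mp hlt)
  have h1 := hv.1
  have h2 := hw.2
  omega

theorem hindsight_cumulative {V : ℕ → ℝ} {n : ℕ} (hV : ∀ t, 1 ≤ t → t ≤ n → 0 ≤ V t)
    {d : ℝ} (hd : 0 ≤ d) :
    ∑ t ∈ Finset.Icc 1 n, min (V t) (max (d - ∑ i ∈ Finset.Ico 1 t, V i) 0)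
      = min d (∑ t ∈ Finset.Icc 1 n, V t) := by
  induction n with
  | zero => simp [hd]
  | succ n ih =>
    have e : Finset.Ico 1 (n + 1) = Finset.Icc 1 n := Finset.Ico_add_one_right_eq_Icc 1 n
    rw [Finset.sum_Icc_succ_top (by omega), Finset.sum_Icc_succ_top (by omega),
      ih (fun t h h' => hV t h (by omega)), e]
    have hv := hV (n + 1) (by omega) le_rfl
    rcases le_total d (∑ t ∈ Finset.Icc 1 n, V t) with h | h
    · rw [min_eq_left h, max_eq_right (by linarith), min_eq_right hv, min_eq_left (by linarith)]
      ring
    · rw [min_eq_right h, max_eq_left (by linarith)]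
      rcases le_total (V (n + 1)) (d - ∑ t ∈ Finset.Icc 1 n, V t) with h' | h'
      · rw [min_eq_left h', min_eq_right (by linarith)]
      · rw [min_eq_right h', min_eq_left (by linarith)]
        ring

theorem planProfit_le_aux {V c a : ℕ → ℝ} {d : ℝ} (hd : 0 ≤ d) (n : ℕ) :
    (∀ t, 1 ≤ t → t ≤ n → 0 ≤ a t ∧ a t ≤ V t) →
    (∀ s t, 1 ≤ s → s ≤ t → t ≤ n → c s ≤ c t) → (∀ t, 1 ≤ t → t ≤ n → 0 ≤ c t) →
    ∀ q : ℝ, (∀ t, 1 ≤ t → t ≤ n → c t ≤ q) → 0 ≤ q →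
    q * min d (∑ t ∈ Finset.Icc 1 n, a t) - ∑ t ∈ Finset.Icc 1 n, c t * a t ≤
      ∑ t ∈ Finset.Icc 1 n, (q - c t) * min (V t) (max (d - ∑ i ∈ Finset.Ico 1 t, V i) 0) := by
  induction n with
  | zero => intro _ _ _ q _ _; simp [hd]
  | succ n ih =>
    intro ha hc hc0 q hq hq0
    have hcn := hc0 (n + 1) (by omega) le_rfl
    have hqn := hq (n + 1) (by omega) le_rfl
    have ih' := ih (fun t h h' => ha t h (by omega))
      (fun s t h h' h'' => hc s t h h' (by omega)) (fun t h h' => hc0 t h (by omega))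
      (c (n + 1)) (fun t h h' => hc t (n + 1) h (by omega) le_rfl) hcn
    have hcum := hindsight_cumulative (V := V) (n := n + 1)
      (fun t h h' => (ha t h h').1.trans (ha t h h').2) hd
    have hle : ∑ t ∈ Finset.Icc 1 (n + 1), a t ≤ ∑ t ∈ Finset.Icc 1 (n + 1), V t :=
      Finset.sum_le_sum fun t ht =>
        (ha t (Finset.mem_Icc.mp ht).1 (Finset.mem_Icc.mp ht).2).2
    have split : ∑ t ∈ Finset.Icc 1 (n + 1),
          (q - c t) * min (V t) (max (d - ∑ i ∈ Finset.Ico 1 t, V i) 0)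
        = (q - c (n + 1)) * min d (∑ t ∈ Finset.Icc 1 (n + 1), V t) +
          ∑ t ∈ Finset.Icc 1 n,
            (c (n + 1) - c t) * min (V t) (max (d - ∑ i ∈ Finset.Ico 1 t, V i) 0) := by
      rw [← hcum, Finset.mul_sum, Finset.sum_Icc_succ_top (by omega),
        Finset.sum_Icc_succ_top (by omega), add_right_comm, ← Finset.sum_add_distrib]
      congr 1
      exact Finset.sum_congr rfl fun t _ => by ring
    rw [split]
    have h1 : (q - c (n + 1)) * min d (∑ t ∈ Finset.Icc 1 (n + 1), a t)
        ≤ (q - c (n + 1)) * min d (∑ t ∈ Finset.Icc 1 (n + 1), V t) :=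
      mul_le_mul_of_nonneg_left (min_le_min le_rfl hle) (by linarith)
    have han := (ha (n + 1) (by omega) le_rfl).1
    have h2 : min d (∑ t ∈ Finset.Icc 1 (n + 1), a t)
        ≤ min d (∑ t ∈ Finset.Icc 1 n, a t) + a (n + 1) := by
      rw [Finset.sum_Icc_succ_top (by omega)]
      rcases le_total d (∑ t ∈ Finset.Icc 1 n, a t) with h | h
      · rw [min_eq_left h]; exact (min_le_left _ _).trans (by linarith)
      · rw [min_eq_right h]; exact min_le_right _ _
    have h3 := mul_le_mul_of_nonneg_left h2 hcn
    rw [Finset.sum_Icc_succ_top (by omega) (fun t => c t * a t)]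
    nlinarith [h1, h3, ih']

/-- The hindsight optimal profit is the largest profit of an order plan within the capacities. -/
theorem isGreatest_hindsight (𝒱 : RMOwP) {d : ℝ} (hd : 0 ≤ d) :
    IsGreatest {r : ℝ | ∃ a : ℕ → ℝ, (∀ t, 1 ≤ t → t ≤ 𝒱.T → 0 ≤ a t ∧ a t ≤ 𝒱.V t) ∧
      r = 𝒱.planProfit a d} (𝒱.hindsight d) := by
  constructor
  · refine ⟨fun t => min (𝒱.V t) (max (d - ∑ i ∈ Finset.Ico 1 t, 𝒱.V i) 0),
      fun t h h' => ⟨le_min (𝒱.V_nonneg t h h') (le_max_right _ _), min_le_left _ _⟩, ?_⟩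
    unfold planProfit hindsight
    rw [hindsight_cumulative 𝒱.V_nonneg hd, min_eq_right (min_le_left _ _),
      ← hindsight_cumulative 𝒱.V_nonneg hd, Finset.mul_sum, ← Finset.sum_sub_distrib]
    exact Finset.sum_congr rfl fun t _ => by ring
  · rintro r ⟨a, ha, rfl⟩
    have hpos : ∀ t, 1 ≤ t → t ≤ 𝒱.T → 0 ≤ 𝒱.cost t ∧ 𝒱.cost t ≤ 𝒱.p := by
      intro t h h'
      obtain ⟨v, hv⟩ := 𝒱.exists_inPhase h h'
      rw [𝒱.cost_eq hv]
      exact ⟨(𝒱.γ_pos v).le, (𝒱.γ_lt_p v).le⟩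
    exact planProfit_le_aux hd 𝒱.T ha (fun s t h h' h'' => 𝒱.cost_mono h h' h'')
      (fun t h h' => (hpos t h h').1) 𝒱.p (fun t h h' => (hpos t h h').2)
      ((hpos 1 le_rfl 𝒱.one_le_T).1.trans (hpos 1 le_rfl 𝒱.one_le_T).2)

/-- The ratio of the profit of `π` to the hindsight optimal profit.  Where the latter is `0` (the
demand or all capacities vanish), the ratio is `1` if `π` makes no loss, and `-∞` otherwise. -/
noncomputable def ratio (𝒱 : RMOwP) (π : 𝒱.Policy) (P : ℕ → ℝ × ℝ) (d : ℝ) : EReal :=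
  open scoped Classical in
  if 𝒱.hindsight d = 0 then (if 0 ≤ 𝒱.profit π P d then 1 else ⊥)
  else ((𝒱.profit π P d / 𝒱.hindsight d : ℝ) : EReal)

/-- The robust competitive ratio of `π`: the infimum of the ratio over all regular prediction
sequences `P` and all demands `d` in the last prediction interval. -/
noncomputable def robustRatio (𝒱 : RMOwP) (π : 𝒱.Policy) : EReal :=
  ⨅ (P : ℕ → ℝ × ℝ) (d : ℝ) (_ : 𝒱.IsRegular P ∧ (P 𝒱.T).1 ≤ d ∧ d ≤ (P 𝒱.T).2), 𝒱.ratio π P d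

/-- The same infimum over the regular prediction sequences in which the interval of each day
`t ∈ {1, …, T}` has length exactly `Δ t`. -/
noncomputable def exactRobustRatio (𝒱 : RMOwP) (π : 𝒱.Policy) : EReal :=
  ⨅ (P : ℕ → ℝ × ℝ) (d : ℝ) (_ : (𝒱.IsRegular P ∧ (P 𝒱.T).1 ≤ d ∧ d ≤ (P 𝒱.T).2) ∧
    ∀ t, 1 ≤ t → t ≤ 𝒱.T → (P t).2 - (P t).1 = 𝒱.Δ t), 𝒱.ratio π P d

/-- The optimal robust competitive ratio: the supremum over all feasible policies. -/
noncomputable def optRatio (𝒱 : RMOwP) : EReal :=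
  ⨆ (π : 𝒱.Policy) (_ : 𝒱.IsFeasible π), 𝒱.robustRatio π

/-- The same supremum for the prediction sequences with intervals of maximal length. -/
noncomputable def exactOptRatio (𝒱 : RMOwP) : EReal :=
  ⨆ (π : 𝒱.Policy) (_ : 𝒱.IsFeasible π), 𝒱.exactRobustRatio π

/-- The input memory for an instance and a threshold `Φ`.  Natural-number cells:
`T, K, τ 0, …, τ K`.  Real cells:
`dlo, dhi, p, Φ, Δ 1, …, Δ T, V 1, …, V T, γ 0, …, γ (K - 1)`.  All other cells are `0`. -/
noncomputable def encode (𝒱 : RMOwP) (Φ : ℝ) : RealRAM.Mem where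
  nat := fun i =>
    if i = 0 then 𝒱.T else if i = 1 then 𝒱.K
    else if h : i - 2 < 𝒱.K + 1 then 𝒱.τ ⟨i - 2, h⟩ else 0
  real := fun i =>
    if i = 0 then 𝒱.dlo else if i = 1 then 𝒱.dhi else if i = 2 then 𝒱.p else if i = 3 then Φ
    else if i < 4 + 𝒱.T then 𝒱.Δ (i - 3)
    else if i < 4 + 2 * 𝒱.T then 𝒱.V (i - 3 - 𝒱.T)
    else if h : i - (4 + 2 * 𝒱.T) < 𝒱.K then 𝒱.γ ⟨i - (4 + 2 * 𝒱.T), h⟩ else 0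

end RMOwP

namespace RMOwP

/-! ### The hindsight profit and the budget it leaves -/

/-! Fix `φ = max Φ 0`; a ratio `Φ ≤ 0` is already reached by ordering nothing. With total cost `S`,
total margin `G = ∑ (p - c t) a t` and demand `d`, the profit is the smaller of `p d - S` and `G`.
Hence it is at least `φ R♯(d)` iff `S ≤ B(d) := p d - φ R♯(d)` and `G ≥ φ R♯(d)`. Both `B` and `R♯`
are nondecreasing on nonnegative demands, so for all demands in an interval it suffices to check the
first condition at the lower end and the second at the upper end (`planProfit_ge_of_endpoints`).

The prediction may stop moving on any day, so the cost spent must never exceed the budget `B` of the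
current lower bound. Since unit costs do not decrease, money spent early earns at least as much per
unit as money spent late: among all plans obeying these budgets, ordering as much as possible every
day maximizes the margin (`sum_margin_le_greedyGain`). The greedy margin grows with the lower bounds
(`greedyGain_mono`). For a final upper bound `h` the least lower bounds are `max (h - Δ t) dlo`, so
a single critical sequence per `h` decides. If all of them are passed, the greedy policy attains `Φ`
(`le_robustRatio_greedyPolicy`). Conversely, each critical sequence and its stopped versions consist
of intervals of exact length, so every policy is confronted with them already in the restricted
problem (`allPass_of_le_exactOptRatio`). This makes the two suprema comparable with the same
criterion.

Finitely many `h` suffice. Between consecutive points of the form `dlo + δ` or `∑_{i<s} V i + δ`,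
where `δ` is `0` or some `Δ k`, all budgets along the critical sequence are affine in `h`; the
greedy margin is then concave in `h` (`concaveOn_greedyGain`), and so is its excess over `φ R♯(h)`.
Nonnegativity at the breakpoints, projected to the range of `h`, and at the two ends of the range
implies it everywhere (`allPass_iff`).

There are `O(T²)` tests with `O(T)` safe orders each, and a safe order takes `O(T²)` steps because
`K ≤ T`. The decider therefore runs in `O(T⁵)` steps (`exec_decider`) and an online query in `O(T²)`
(`exec_online`), within the bound `C T^(CK)`. -/

theorem cost_pos (𝒱 : RMOwP) {t : ℕ} (h₁ : 1 ≤ t) (h₂ : t ≤ 𝒱.T) : 0 < 𝒱.cost t := by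
  obtain ⟨v, hv⟩ := 𝒱.exists_inPhase h₁ h₂
  rw [𝒱.cost_eq hv]
  exact 𝒱.γ_pos v

theorem cost_lt_p (𝒱 : RMOwP) {t : ℕ} (h₁ : 1 ≤ t) (h₂ : t ≤ 𝒱.T) : 𝒱.cost t < 𝒱.p := by
  obtain ⟨v, hv⟩ := 𝒱.exists_inPhase h₁ h₂
  rw [𝒱.cost_eq hv]
  exact 𝒱.γ_lt_p v

/-- The inventory recursion starts at day `0`, which lies before every phase; whatever a policy
returns there must not be charged. -/
theorem cost_zero (𝒱 : RMOwP) : 𝒱.cost 0 = 0 := by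
  refine Finset.sum_eq_zero fun v _ => if_neg ?_
  rintro ⟨h, -⟩
  have := 𝒱.τ_strictMono.monotone (Fin.zero_le v.castSucc)
  rw [𝒱.τ_zero] at this
  omega

theorem p_pos (𝒱 : RMOwP) : 0 < 𝒱.p :=
  (𝒱.cost_pos le_rfl 𝒱.one_le_T).trans (𝒱.cost_lt_p le_rfl 𝒱.one_le_T)

theorem hindsight_mono (𝒱 : RMOwP) : Monotone 𝒱.hindsight := by
  intro d d' h
  refine Finset.sum_le_sum fun t ht => ?_
  rw [Finset.mem_Icc] at ht
  refine mul_le_mul_of_nonneg_left ?_ (sub_nonneg.2 (𝒱.cost_lt_p ht.1 ht.2).le)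
  exact min_le_min le_rfl (max_le_max (by linarith) le_rfl)

theorem hindsight_zero (𝒱 : RMOwP) : 𝒱.hindsight 0 = 0 := by
  refine Finset.sum_eq_zero fun t ht => ?_
  rw [Finset.mem_Icc] at ht
  have h : 0 ≤ ∑ i ∈ Finset.Ico 1 t, 𝒱.V i := Finset.sum_nonneg fun i hi => by
    rw [Finset.mem_Ico] at hi
    exact 𝒱.V_nonneg i hi.1 (by omega)
  rw [max_eq_right (by linarith), min_eq_right (𝒱.V_nonneg t ht.1 ht.2), mul_zero]

theorem hindsight_nonneg (𝒱 : RMOwP) {d : ℝ} (hd : 0 ≤ d) : 0 ≤ 𝒱.hindsight d :=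
  𝒱.hindsight_zero ▸ 𝒱.hindsight_mono hd

/-- Extra demand adds extra orders with unit margin at most `p`, and the hindsight orders add up to
the demand capped by the total capacity. This is what makes the budget nondecreasing for `φ ≤ 1`. -/
theorem hindsight_sub_le (𝒱 : RMOwP) {d d' : ℝ} (hd : 0 ≤ d) (h : d ≤ d') :
    𝒱.hindsight d' - 𝒱.hindsight d ≤ 𝒱.p * (d' - d) := by
  have e := hindsight_cumulative 𝒱.V_nonneg hd
  have e' := hindsight_cumulative 𝒱.V_nonneg (hd.trans h)
  have hle : min d' (∑ t ∈ Finset.Icc 1 𝒱.T, 𝒱.V t) - min d (∑ t ∈ Finset.Icc 1 𝒱.T, 𝒱.V t)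
      ≤ d' - d := by
    rcases le_total d (∑ t ∈ Finset.Icc 1 𝒱.T, 𝒱.V t) with h' | h'
    · rw [min_eq_left h']
      linarith [min_le_left d' (∑ t ∈ Finset.Icc 1 𝒱.T, 𝒱.V t)]
    · rw [min_eq_right h']
      linarith [min_le_right d' (∑ t ∈ Finset.Icc 1 𝒱.T, 𝒱.V t)]
  refine le_trans ?_ (mul_le_mul_of_nonneg_left hle 𝒱.p_pos.le)
  rw [← e, ← e', ← Finset.sum_sub_distrib, hindsight, hindsight, ← Finset.sum_sub_distrib,
    Finset.mul_sum]
  refine Finset.sum_le_sum fun t ht => ?_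
  rw [Finset.mem_Icc] at ht
  rw [← mul_sub]
  refine mul_le_mul_of_nonneg_right (by linarith [𝒱.cost_pos ht.1 ht.2]) (sub_nonneg.2 ?_)
  exact min_le_min le_rfl (max_le_max (by linarith) le_rfl)

/-- The largest total ordering cost with which a profit of at least `φ` times the hindsight optimum
is still possible for demand `d`. -/
noncomputable def budget (𝒱 : RMOwP) (φ d : ℝ) : ℝ := 𝒱.p * d - φ * 𝒱.hindsight d

theorem budget_mono (𝒱 : RMOwP) {φ d d' : ℝ} (h1 : φ ≤ 1) (hd : 0 ≤ d)
    (h : d ≤ d') : 𝒱.budget φ d ≤ 𝒱.budget φ d' := by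
  have h2 := 𝒱.hindsight_sub_le hd h
  have h3 := 𝒱.hindsight_mono h
  have h4 := mul_le_mul_of_nonneg_right h1 (sub_nonneg.2 h3)
  unfold budget
  linarith

theorem budget_nonneg (𝒱 : RMOwP) {φ d : ℝ} (h1 : φ ≤ 1) (hd : 0 ≤ d) :
    0 ≤ 𝒱.budget φ d := by
  have := 𝒱.budget_mono h1 le_rfl hd
  rwa [budget, 𝒱.hindsight_zero, mul_zero, mul_zero, sub_zero] at this

/-! ### The greedy policy -/

/-- The largest order on day `t` within the capacity that keeps the total ordering cost, currently
`s`, below the budget for demand `lo`. -/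
noncomputable def safeOrder (𝒱 : RMOwP) (φ : ℝ) (t : ℕ) (lo s : ℝ) : ℝ :=
  max (min ((𝒱.budget φ lo - s) / 𝒱.cost t) (𝒱.V t)) 0

/-- The total ordering cost after day `t` of the safe orders along lower prediction bounds `l`. -/
noncomputable def greedySpend (𝒱 : RMOwP) (φ : ℝ) (l : ℕ → ℝ) : ℕ → ℝ
  | 0 => 0
  | t + 1 => 𝒱.greedySpend φ l t +
      𝒱.cost (t + 1) * 𝒱.safeOrder φ (t + 1) (l (t + 1)) (𝒱.greedySpend φ l t)

/-- The total margin after day `t` of the safe orders along lower prediction bounds `l`. -/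
noncomputable def greedyGain (𝒱 : RMOwP) (φ : ℝ) (l : ℕ → ℝ) : ℕ → ℝ
  | 0 => 0
  | t + 1 => 𝒱.greedyGain φ l t +
      (𝒱.p - 𝒱.cost (t + 1)) * 𝒱.safeOrder φ (t + 1) (l (t + 1)) (𝒱.greedySpend φ l t)

theorem safeOrder_nonneg (𝒱 : RMOwP) (φ : ℝ) (t : ℕ) (lo s : ℝ) : 0 ≤ 𝒱.safeOrder φ t lo s :=
  le_max_right _ _

theorem safeOrder_le (𝒱 : RMOwP) (φ : ℝ) {t : ℕ} (h₁ : 1 ≤ t) (h₂ : t ≤ 𝒱.T) (lo s : ℝ) :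
    𝒱.safeOrder φ t lo s ≤ 𝒱.V t :=
  max_le (min_le_right _ _) (𝒱.V_nonneg t h₁ h₂)

/-- A nondecreasing sequence of nonnegative lower prediction bounds. -/
structure IsLowerPath (𝒱 : RMOwP) (l : ℕ → ℝ) : Prop where
  nonneg : ∀ t, 1 ≤ t → t ≤ 𝒱.T → 0 ≤ l t
  mono : ∀ t, 1 ≤ t → t < 𝒱.T → l t ≤ l (t + 1)

/-- Rising lower bounds give rising budgets, so the greedy spending never overshoots the next
budget. The truncation at `0` in `safeOrder` is then inactive, and the recursion becomes a plain
minimum, the form that both the optimality and the concavity argument use. -/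
theorem greedySpend_le_and_succ (𝒱 : RMOwP) {φ : ℝ} (hφ : φ ≤ 1) {l : ℕ → ℝ}
    (hl : 𝒱.IsLowerPath l) {t : ℕ} (ht : t < 𝒱.T) :
    𝒱.greedySpend φ l t ≤ 𝒱.budget φ (l (t + 1)) ∧
    𝒱.greedySpend φ l (t + 1) =
      min (𝒱.budget φ (l (t + 1))) (𝒱.greedySpend φ l t + 𝒱.cost (t + 1) * 𝒱.V (t + 1)) := by
  have step : ∀ t, t < 𝒱.T → 𝒱.greedySpend φ l t ≤ 𝒱.budget φ (l (t + 1)) →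
      𝒱.greedySpend φ l (t + 1) =
      min (𝒱.budget φ (l (t + 1)))
        (𝒱.greedySpend φ l t + 𝒱.cost (t + 1) * 𝒱.V (t + 1)) := by
    intro t ht h
    have hc := 𝒱.cost_pos (t := t + 1) (by omega) ht
    have hV := 𝒱.V_nonneg (t + 1) (by omega) ht
    rw [greedySpend, safeOrder, max_eq_left
      (le_min (div_nonneg (sub_nonneg.2 h) hc.le) hV), mul_min_of_nonneg _ _ hc.le,
      mul_div_cancel₀ _ hc.ne', ← min_add_add_left, add_sub_cancel]
  have main : ∀ t, t < 𝒱.T → 𝒱.greedySpend φ l t ≤ 𝒱.budget φ (l (t + 1)) := by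
    intro t
    induction t with
    | zero => intro ht; exact 𝒱.budget_nonneg hφ (hl.nonneg 1 le_rfl ht)
    | succ t ih =>
      intro ht
      rw [step t (by omega) (ih (by omega))]
      exact (min_le_left _ _).trans
        (𝒱.budget_mono hφ (hl.nonneg _ (by omega) ht.le) (hl.mono _ (by omega) ht))
  exact ⟨main t ht, step t ht (main t ht)⟩

theorem greedySpend_le (𝒱 : RMOwP) {φ : ℝ} (hφ : φ ≤ 1) {l : ℕ → ℝ}
    (hl : 𝒱.IsLowerPath l) {t : ℕ} (h1 : 1 ≤ t) (ht : t ≤ 𝒱.T) :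
    𝒱.greedySpend φ l t ≤ 𝒱.budget φ (l t) := by
  obtain ⟨t, rfl⟩ : ∃ s, t = s + 1 := ⟨t - 1, by omega⟩
  rw [(𝒱.greedySpend_le_and_succ hφ hl ht).2]
  exact min_le_left _ _

/-- The greedy orders have the largest total margin among all orders within the capacities whose
total ordering cost always stays below the current budget. -/
theorem sum_margin_le_greedyGain (𝒱 : RMOwP) {φ : ℝ} (hφ : φ ≤ 1) {l : ℕ → ℝ}
    (hl : 𝒱.IsLowerPath l) {a : ℕ → ℝ} (ha : ∀ t, 1 ≤ t → t ≤ 𝒱.T → a t ≤ 𝒱.V t)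
    (hs : ∀ t, 1 ≤ t → t ≤ 𝒱.T → ∑ s ∈ Finset.Icc 1 t, 𝒱.cost s * a s ≤ 𝒱.budget φ (l t)) :
    ∑ t ∈ Finset.Icc 1 𝒱.T, (𝒱.p - 𝒱.cost t) * a t ≤ 𝒱.greedyGain φ l 𝒱.T := by
  -- Greedy also spends the most up to each day: both terms of the minimum in its recursion bound
  -- every admissible plan.
  have spend : ∀ t, t ≤ 𝒱.T →
      ∑ s ∈ Finset.Icc 1 t, 𝒱.cost s * a s ≤ 𝒱.greedySpend φ l t := by
    intro t
    induction t with
    | zero => intro _; simp [greedySpend]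
    | succ t ih =>
      intro ht
      rw [(𝒱.greedySpend_le_and_succ hφ hl ht).2]
      refine le_min (hs _ (by omega) ht) ?_
      rw [Finset.sum_Icc_succ_top (by omega)]
      exact add_le_add (ih (by omega)) (mul_le_mul_of_nonneg_left (ha _ (by omega) ht)
        (𝒱.cost_pos (by omega) ht).le)
  -- Abel summation. A unit of money spent on day `s` earns `p / cost s - 1`, which does not
  -- increase with `s`. The lead in margin dominates `q` times the lead in spending for every `q`
  -- below all rates so far; the induction hypothesis is applied with the rate of the new day, and
  -- `q = 0` gives the claim.
  have main : ∀ n, n ≤ 𝒱.T → ∀ q : ℝ, (∀ s, 1 ≤ s → s ≤ n → q ≤ 𝒱.p / 𝒱.cost s - 1) →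
      q * (𝒱.greedySpend φ l n - ∑ s ∈ Finset.Icc 1 n, 𝒱.cost s * a s) ≤
      𝒱.greedyGain φ l n - ∑ t ∈ Finset.Icc 1 n, (𝒱.p - 𝒱.cost t) * a t := by
    intro n
    induction n with
    | zero => intro _ q _; simp [greedySpend, greedyGain]
    | succ n ih =>
      intro hn q hq
      have hc := 𝒱.cost_pos (t := n + 1) (by omega) hn
      have h1 := ih (by omega) (𝒱.p / 𝒱.cost (n + 1) - 1) (fun s h h' => by
        have := 𝒱.cost_mono h (show s ≤ n + 1 by omega) hn
        have := div_le_div_of_nonneg_left 𝒱.p_pos.le (𝒱.cost_pos h (by omega)) this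
        linarith)
      have h2 := mul_le_mul_of_nonneg_right (hq (n + 1) (by omega) le_rfl)
        (sub_nonneg.2 (spend (n + 1) hn))
      refine h2.trans ?_
      rw [Finset.sum_Icc_succ_top (by omega), Finset.sum_Icc_succ_top (by omega), greedySpend,
        greedyGain]
      have e : ∀ y : ℝ, (𝒱.p / 𝒱.cost (n + 1) - 1) * (𝒱.cost (n + 1) * y)
          = (𝒱.p - 𝒱.cost (n + 1)) * y := by
        intro y
        field_simp
      have e1 := e (𝒱.safeOrder φ (n + 1) (l (n + 1)) (𝒱.greedySpend φ l n))
      have e2 := e (a (n + 1))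
      linarith
  have := main 𝒱.T le_rfl 0 (fun s h h' => by
    have := (one_le_div (𝒱.cost_pos h h')).2 (𝒱.cost_lt_p h h').le
    linarith)
  linarith

theorem greedySpend_eq_sum (𝒱 : RMOwP) (φ : ℝ) (l : ℕ → ℝ) (n : ℕ) :
    𝒱.greedySpend φ l n = ∑ t ∈ Finset.Icc 1 n,
      𝒱.cost t * 𝒱.safeOrder φ t (l t) (𝒱.greedySpend φ l (t - 1)) := by
  induction n with
  | zero => simp [greedySpend]
  | succ n ih =>
    rw [Finset.sum_Icc_succ_top (by omega), ← ih, greedySpend, Nat.add_sub_cancel]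

theorem greedyGain_eq_sum (𝒱 : RMOwP) (φ : ℝ) (l : ℕ → ℝ) (n : ℕ) :
    𝒱.greedyGain φ l n = ∑ t ∈ Finset.Icc 1 n,
      (𝒱.p - 𝒱.cost t) * 𝒱.safeOrder φ t (l t) (𝒱.greedySpend φ l (t - 1)) := by
  induction n with
  | zero => simp [greedyGain]
  | succ n ih =>
    rw [Finset.sum_Icc_succ_top (by omega), ← ih, greedyGain, Nat.add_sub_cancel]

/-- The greedy plan for the lower path respects the larger budgets of the higher path, where greedy
is optimal. -/
theorem greedyGain_mono (𝒱 : RMOwP) {φ : ℝ} (hφ : φ ≤ 1) {l l' : ℕ → ℝ}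
    (hl : 𝒱.IsLowerPath l) (hl' : 𝒱.IsLowerPath l') (h : ∀ t, 1 ≤ t → t ≤ 𝒱.T → l t ≤ l' t) :
    𝒱.greedyGain φ l 𝒱.T ≤ 𝒱.greedyGain φ l' 𝒱.T := by
  rw [𝒱.greedyGain_eq_sum φ l]
  refine 𝒱.sum_margin_le_greedyGain hφ hl' (fun t h1 h2 => 𝒱.safeOrder_le φ h1 h2 _ _)
    fun t h1 h2 => ?_
  rw [← greedySpend_eq_sum]
  exact (𝒱.greedySpend_le hφ hl h1 h2).trans
    (𝒱.budget_mono hφ (hl.nonneg t h1 h2) (h t h1 h2))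

theorem continuous_greedyGain (𝒱 : RMOwP) (l : ℕ → ℝ) (n : ℕ) :
    Continuous fun φ => 𝒱.greedyGain φ l n := by
  have hs : ∀ n, Continuous fun φ => 𝒱.greedySpend φ l n := by
    intro n
    induction n with
    | zero => exact continuous_const
    | succ n ih =>
      unfold greedySpend safeOrder budget
      fun_prop
  induction n with
  | zero => exact continuous_const
  | succ n ih =>
    have := hs n
    unfold greedyGain safeOrder budget
    fun_prop

/-! ### The critical prediction sequences -/

/-- The lower prediction bounds of a sequence of longest prediction intervals whose upper bound
stays as close to `h` as possible. -/
def worstPath (𝒱 : RMOwP) (h : ℝ) (t : ℕ) : ℝ := max (h - 𝒱.Δ t) 𝒱.dlo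

/-- Along the lower prediction bounds `worstPath h`, the greedy orders are profitable enough for
demand `h`. -/
def Passes (𝒱 : RMOwP) (φ h : ℝ) : Prop :=
  φ * 𝒱.hindsight h ≤ 𝒱.greedyGain φ (𝒱.worstPath h) 𝒱.T

/-- All critical prediction sequences are passed. -/
def AllPass (𝒱 : RMOwP) (φ : ℝ) : Prop :=
  ∀ h, 𝒱.dlo + 𝒱.Δ 𝒱.T ≤ h → h ≤ 𝒱.dhi → 𝒱.Passes φ h

theorem isLowerPath_worstPath (𝒱 : RMOwP) (h : ℝ) : 𝒱.IsLowerPath (𝒱.worstPath h) where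
  nonneg _ _ _ := 𝒱.dlo_nonneg.trans (le_max_right _ _)
  mono t h1 h2 := max_le_max (by linarith [𝒱.Δ_anti t h1 h2]) le_rfl

theorem Δ_le (𝒱 : RMOwP) {s t : ℕ} (h1 : 1 ≤ s) (hst : s ≤ t) (ht : t ≤ 𝒱.T) :
    𝒱.Δ t ≤ 𝒱.Δ s := by
  induction t, hst using Nat.le_induction with
  | base => exact le_rfl
  | succ t hst ih => exact (𝒱.Δ_anti t (by omega) ht).trans (ih (by omega))

theorem dlo_add_Δ_le (𝒱 : RMOwP) {t : ℕ} (h1 : 1 ≤ t) (ht : t ≤ 𝒱.T) :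
    𝒱.dlo + 𝒱.Δ t ≤ 𝒱.dhi := by
  linarith [𝒱.Δ_le le_rfl h1 ht, 𝒱.Δ_one_le]

/-- Of the two terms of the profit, the one limited by demand is worst at the lower end because the
budget is monotone, and the one limited by supply at the upper end because `φ ≥ 0` and the hindsight
profit is monotone. -/
theorem planProfit_ge_of_endpoints (𝒱 : RMOwP) {φ : ℝ} (h0 : 0 ≤ φ) (h1 : φ ≤ 1) {a : ℕ → ℝ}
    {lo hi d : ℝ} (hlo : 0 ≤ lo) (hld : lo ≤ d) (hdh : d ≤ hi)
    (hs : ∑ t ∈ Finset.Icc 1 𝒱.T, 𝒱.cost t * a t ≤ 𝒱.budget φ lo)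
    (hg : φ * 𝒱.hindsight hi ≤ ∑ t ∈ Finset.Icc 1 𝒱.T, (𝒱.p - 𝒱.cost t) * a t) :
    φ * 𝒱.hindsight d ≤ 𝒱.planProfit a d := by
  unfold planProfit
  rw [mul_min_of_nonneg _ _ 𝒱.p_pos.le, ← min_sub_sub_right]
  refine le_min ?_ ?_
  · have := 𝒱.budget_mono h1 hlo hld
    have e : 𝒱.budget φ d = 𝒱.p * d - φ * 𝒱.hindsight d := rfl
    linarith
  · rw [Finset.mul_sum, ← Finset.sum_sub_distrib]
    simp only [← sub_mul]
    exact (mul_le_mul_of_nonneg_left (𝒱.hindsight_mono hdh) h0).trans hg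

/-- The factor `max Φ 0` serves both branches of the ratio: where the hindsight profit vanishes it
yields a nonnegative profit and so the ratio `1 ≥ Φ`. -/
theorem le_ratio (𝒱 : RMOwP) {Φ : ℝ} (hΦ : Φ ≤ 1) {π : 𝒱.Policy} {P : ℕ → ℝ × ℝ} {d : ℝ}
    (hd : 0 ≤ d) (h : max Φ 0 * 𝒱.hindsight d ≤ 𝒱.profit π P d) :
    (Φ : EReal) ≤ 𝒱.ratio π P d := by
  unfold ratio
  split_ifs with h1 h2
  · exact_mod_cast hΦ
  · rw [h1, mul_zero] at h
    exact absurd h h2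
  · have hpos := lt_of_le_of_ne (𝒱.hindsight_nonneg hd) (Ne.symm h1)
    rw [EReal.coe_le_coe_iff, le_div_iff₀ hpos]
    exact (mul_le_mul_of_nonneg_right (le_max_left _ _) hpos.le).trans h

theorem le_profit_of_le_ratio (𝒱 : RMOwP) {Φ : ℝ} {π : 𝒱.Policy} {P : ℕ → ℝ × ℝ} {d : ℝ}
    (hd : 0 ≤ d) (h : (Φ : EReal) ≤ 𝒱.ratio π P d) : Φ * 𝒱.hindsight d ≤ 𝒱.profit π P d := by
  unfold ratio at h
  split_ifs at h with h1 h2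
  · rw [h1, mul_zero]; exact h2
  · exact absurd (le_bot_iff.1 h) (EReal.coe_ne_bot Φ)
  · have hpos := lt_of_le_of_ne (𝒱.hindsight_nonneg hd) (Ne.symm h1)
    rwa [EReal.coe_le_coe_iff, le_div_iff₀ hpos] at h

/-! ### Sufficiency of the critical sequences -/

/-- The policy that always places the safe order. -/
noncomputable def greedyPolicy (𝒱 : RMOwP) (φ : ℝ) : 𝒱.Policy :=
  fun t I x => 𝒱.safeOrder φ t I.1 (∑ v, 𝒱.γ v * x v)

theorem isFeasible_greedyPolicy (𝒱 : RMOwP) (φ : ℝ) : 𝒱.IsFeasible (𝒱.greedyPolicy φ) :=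
  fun _ h1 h2 _ _ _ _ => ⟨𝒱.safeOrder_nonneg _ _ _ _, 𝒱.safeOrder_le _ h1 h2 _ _⟩

theorem sum_inventory_succ (𝒱 : RMOwP) (π : 𝒱.Policy) (P : ℕ → ℝ × ℝ) (t : ℕ) :
    ∑ v, 𝒱.γ v * 𝒱.inventory π P (t + 1) v =
      ∑ v, 𝒱.γ v * 𝒱.inventory π P t v + 𝒱.cost t * 𝒱.order π P t := by
  rw [cost, Finset.sum_mul, ← Finset.sum_add_distrib]
  refine Finset.sum_congr rfl fun v _ => ?_
  by_cases h : 𝒱.InPhase v t <;> simp only [inventory, order, h, if_true, if_false] <;> ring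

theorem sum_inventory_greedyPolicy (𝒱 : RMOwP) (φ : ℝ) (P : ℕ → ℝ × ℝ) (t : ℕ) :
    ∑ v, 𝒱.γ v * 𝒱.inventory (𝒱.greedyPolicy φ) P (t + 1) v =
      𝒱.greedySpend φ (fun s => (P s).1) t := by
  induction t with
  | zero => rw [sum_inventory_succ, cost_zero]; simp [inventory, greedySpend]
  | succ t ih => rw [sum_inventory_succ, ih, greedySpend, order, greedyPolicy, ih]

theorem order_greedyPolicy (𝒱 : RMOwP) (φ : ℝ) (P : ℕ → ℝ × ℝ) {t : ℕ} (ht : 1 ≤ t) :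
    𝒱.order (𝒱.greedyPolicy φ) P t =
      𝒱.safeOrder φ t (P t).1 (𝒱.greedySpend φ (fun s => (P s).1) (t - 1)) := by
  obtain ⟨t, rfl⟩ : ∃ s, t = s + 1 := ⟨t - 1, by omega⟩
  rw [order, greedyPolicy, sum_inventory_greedyPolicy, Nat.add_sub_cancel]

theorem IsRegular.subset {𝒱 : RMOwP} {P : ℕ → ℝ × ℝ} (hP : 𝒱.IsRegular P) {s t : ℕ}
    (hst : s ≤ t) (ht : t ≤ 𝒱.T) : (P s).1 ≤ (P t).1 ∧ (P t).2 ≤ (P s).2 := by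
  induction t, hst using Nat.le_induction with
  | base => exact ⟨le_rfl, le_rfl⟩
  | succ t hst ih =>
    have h1 := ih (by omega)
    have h2 := hP.nested t ht
    exact ⟨h1.1.trans h2.1, h2.2.trans h1.2⟩

theorem IsRegular.dlo_le {𝒱 : RMOwP} {P : ℕ → ℝ × ℝ} (hP : 𝒱.IsRegular P) {t : ℕ}
    (ht : t ≤ 𝒱.T) : 𝒱.dlo ≤ (P t).1 ∧ (P t).2 ≤ 𝒱.dhi := by
  have := hP.subset (Nat.zero_le t) ht
  rwa [hP.start] at this

theorem le_robustRatio_greedyPolicy (𝒱 : RMOwP) {Φ : ℝ} (hΦ : Φ ≤ 1)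
    (h : 𝒱.AllPass (max Φ 0)) : (Φ : EReal) ≤ 𝒱.robustRatio (𝒱.greedyPolicy (max Φ 0)) := by
  refine le_iInf fun P => le_iInf fun d => le_iInf ?_
  rintro ⟨hP, hd1, hd2⟩
  have hT := 𝒱.one_le_T
  have hlo := hP.dlo_le le_rfl
  have hlo0 := 𝒱.dlo_nonneg
  have h1 : max Φ 0 ≤ 1 := max_le hΦ zero_le_one
  have h0 : 0 ≤ max Φ 0 := le_max_right _ _
  refine 𝒱.le_ratio hΦ (by linarith) ?_
  have hl : 𝒱.IsLowerPath fun s => (P s).1 :=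
    ⟨fun t _ ht => hlo0.trans (hP.dlo_le ht).1, fun t _ ht => (hP.nested t ht).1⟩
  refine 𝒱.planProfit_ge_of_endpoints h0 h1 (by linarith) hd1 hd2 ?_ ?_
  · rw [Finset.sum_congr rfl fun t ht => by
      rw [𝒱.order_greedyPolicy _ P (Finset.mem_Icc.1 ht).1], ← greedySpend_eq_sum]
    exact 𝒱.greedySpend_le h1 hl hT le_rfl
  · rw [Finset.sum_congr rfl fun t ht => by
      rw [𝒱.order_greedyPolicy _ P (Finset.mem_Icc.1 ht).1], ← greedyGain_eq_sum]
    -- The last interval may be shorter than `Δ T`, so its upper end can lie below the range of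
    -- critical demands. Raising it to `dlo + Δ T` is harmless: there `worstPath` equals `dlo` on
    -- every day.
    have hh := h (max (P 𝒱.T).2 (𝒱.dlo + 𝒱.Δ 𝒱.T)) (le_max_right _ _)
      (max_le hlo.2 (𝒱.dlo_add_Δ_le hT le_rfl))
    refine (mul_le_mul_of_nonneg_left (𝒱.hindsight_mono (le_max_left _ _)) h0).trans
      (hh.trans (𝒱.greedyGain_mono h1 (𝒱.isLowerPath_worstPath _) hl fun t ht1 ht2 => ?_))
    have e1 := hP.dlo_le ht2
    have e2 := hP.subset ht2 le_rfl
    have e3 := hP.error t ht1 ht2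
    have e4 := 𝒱.Δ_le ht1 ht2 le_rfl
    refine max_le ?_ e1.1
    rcases max_cases (P 𝒱.T).2 (𝒱.dlo + 𝒱.Δ 𝒱.T) with h | h <;> rw [h.1] <;> linarith

/-! ### Necessity of the critical sequences -/

theorem inventory_congr (𝒱 : RMOwP) (π : 𝒱.Policy) {P P' : ℕ → ℝ × ℝ} {t : ℕ}
    (h : ∀ s < t, P s = P' s) : 𝒱.inventory π P t = 𝒱.inventory π P' t := by
  induction t with
  | zero => rfl
  | succ t ih =>
    funext v
    rw [inventory, inventory, ih fun s hs => h s (by omega), h t (by omega)]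

/-- Causality: a policy cannot distinguish a critical sequence from its stopped version before they
separate. -/
theorem order_congr (𝒱 : RMOwP) (π : 𝒱.Policy) {P P' : ℕ → ℝ × ℝ} {t : ℕ}
    (h : ∀ s ≤ t, P s = P' s) : 𝒱.order π P t = 𝒱.order π P' t := by
  rw [order, order, h t le_rfl, 𝒱.inventory_congr π fun s hs => h s hs.le]

/-- The longest prediction intervals with lower bounds `l`. -/
def longest (𝒱 : RMOwP) (l : ℕ → ℝ) (t : ℕ) : ℝ × ℝ :=
  if t = 0 then (𝒱.dlo, 𝒱.dhi) else (l t, l t + 𝒱.Δ t)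

theorem longest_of_pos (𝒱 : RMOwP) (l : ℕ → ℝ) {t : ℕ} (ht : 1 ≤ t) :
    𝒱.longest l t = (l t, l t + 𝒱.Δ t) := if_neg (by omega)

/-- `worstPath h` up to day `n`, constant afterwards. -/
def stoppedPath (𝒱 : RMOwP) (h : ℝ) (n t : ℕ) : ℝ := 𝒱.worstPath h (min t n)

/-- Until day `n` the upper bounds are `max h (dlo + Δ t)`, which do not increase and start below
`dhi`. After day `n` the lower bound is frozen, and the intervals shrink from above. -/
theorem isRegular_stoppedPath (𝒱 : RMOwP) {h : ℝ} (hh : h ≤ 𝒱.dhi) {n : ℕ} (hn : 1 ≤ n) :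
    𝒱.IsRegular (𝒱.longest (𝒱.stoppedPath h n)) where
  start := rfl
  le t h1 h2 := by
    rw [longest_of_pos _ _ h1]
    linarith [𝒱.Δ_nonneg t h1 h2]
  error t h1 h2 := by
    rw [longest_of_pos _ _ h1]
    linarith
  nested t ht := by
    rw [longest_of_pos _ _ (show 1 ≤ t + 1 by omega)]
    rcases Nat.eq_zero_or_pos t with rfl | h1
    · have e : min (0 + 1) n = 1 := by omega
      simp only [longest, if_true, stoppedPath, e, worstPath]
      refine ⟨le_max_right _ _, ?_⟩
      have := 𝒱.Δ_one_le
      rw [← max_add_add_right]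
      exact max_le (by simpa using hh) (by simpa using by linarith)
    · rw [longest_of_pos _ _ h1]
      simp only [stoppedPath]
      have hΔ := 𝒱.Δ_anti t h1 ht
      rcases le_or_gt n t with h2 | h2
      · rw [min_eq_right h2, min_eq_right (by omega)]
        exact ⟨le_rfl, by linarith⟩
      · rw [min_eq_left h2.le, min_eq_left (by omega)]
        refine ⟨(𝒱.isLowerPath_worstPath h).mono t h1 ht, ?_⟩
        simp only [worstPath]
        rw [← max_add_add_right, ← max_add_add_right]
        exact max_le_max (by linarith) (by linarith)

theorem longest_exact (𝒱 : RMOwP) (l : ℕ → ℝ) {t : ℕ} (ht : 1 ≤ t) :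
    (𝒱.longest l t).2 - (𝒱.longest l t).1 = 𝒱.Δ t := by
  rw [longest_of_pos _ _ ht]
  simp

/-- The full critical sequence with demand `x` forces a large margin. The sequence stopped at day
`n`, with demand equal to its final lower bound, forces the spending up to day `n` below the budget.
Optimality of greedy under these budgets transfers the margin to greedy. -/
theorem allPass_of_le_exactRobustRatio (𝒱 : RMOwP) {φ : ℝ} (h1 : φ ≤ 1)
    {π : 𝒱.Policy} (hπ : 𝒱.IsFeasible π) (h : (φ : EReal) ≤ 𝒱.exactRobustRatio π) :
    𝒱.AllPass φ := by
  intro x hx1 hx2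
  have hT := 𝒱.one_le_T
  have hlo := 𝒱.dlo_nonneg
  have key : ∀ n, 1 ≤ n → n ≤ 𝒱.T → ∀ d,
      (𝒱.longest (𝒱.stoppedPath x n) 𝒱.T).1 ≤ d → d ≤ (𝒱.longest (𝒱.stoppedPath x n) 𝒱.T).2 →
      φ * 𝒱.hindsight d ≤ 𝒱.profit π (𝒱.longest (𝒱.stoppedPath x n)) d := by
    intro n hn1 hn2 d hd1 hd2
    have hreg := 𝒱.isRegular_stoppedPath hx2 hn1
    refine 𝒱.le_profit_of_le_ratio (hlo.trans ((hreg.dlo_le le_rfl).1.trans hd1)) (h.trans ?_)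
    exact (iInf_le _ _).trans ((iInf_le _ d).trans
      (iInf_le _ ⟨⟨hreg, hd1, hd2⟩, fun t ht _ => 𝒱.longest_exact _ ht⟩))
  have hfeas : ∀ n, 1 ≤ n → n ≤ 𝒱.T → ∀ t, 1 ≤ t → t ≤ 𝒱.T →
      0 ≤ 𝒱.order π (𝒱.longest (𝒱.stoppedPath x n)) t ∧
      𝒱.order π (𝒱.longest (𝒱.stoppedPath x n)) t ≤ 𝒱.V t := by
    intro n hn1 hn2 t ht1 ht2
    have hreg := 𝒱.isRegular_stoppedPath hx2 hn1
    exact hπ t ht1 ht2 _ (sub_nonneg.2 (hreg.le t ht1 ht2)) (hreg.error t ht1 ht2) _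
  -- As `x ≥ dlo + Δ T`, the last interval ends exactly at `x`, so `x` is an allowed demand.
  have hwT : 𝒱.worstPath x 𝒱.T = x - 𝒱.Δ 𝒱.T := max_eq_left (by linarith)
  have hgain : φ * 𝒱.hindsight x ≤
      ∑ t ∈ Finset.Icc 1 𝒱.T,
        (𝒱.p - 𝒱.cost t) * 𝒱.order π (𝒱.longest (𝒱.stoppedPath x 𝒱.T)) t := by
    have hk := key 𝒱.T hT le_rfl x
    rw [longest_of_pos _ _ hT, stoppedPath, min_self, hwT] at hk
    refine (hk (by linarith [𝒱.Δ_nonneg 𝒱.T hT le_rfl]) (by linarith)).trans ?_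
    simp only [sub_mul]
    rw [Finset.sum_sub_distrib, ← Finset.mul_sum]
    exact sub_le_sub_right (mul_le_mul_of_nonneg_left (min_le_right _ _) 𝒱.p_pos.le) _
  refine hgain.trans (𝒱.sum_margin_le_greedyGain h1 (𝒱.isLowerPath_worstPath x)
    (fun t ht1 ht2 => (hfeas _ hT le_rfl t ht1 ht2).2) fun n hn1 hn2 => ?_)
  have hk := key n hn1 hn2 (𝒱.worstPath x n)
  rw [longest_of_pos _ _ hT, stoppedPath, min_eq_right hn2] at hk
  have hk' := hk le_rfl (by linarith [𝒱.Δ_nonneg 𝒱.T hT le_rfl])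
  have hp := mul_le_mul_of_nonneg_left (min_le_left (𝒱.worstPath x n)
    (∑ t ∈ Finset.Icc 1 𝒱.T, 𝒱.order π (𝒱.longest (𝒱.stoppedPath x n)) t)) 𝒱.p_pos.le
  -- Up to day `n` the orders on both sequences coincide; the later orders of the stopped one only
  -- add cost.
  have hsum : ∑ s ∈ Finset.Icc 1 n, 𝒱.cost s * 𝒱.order π (𝒱.longest (𝒱.stoppedPath x 𝒱.T)) s
      ≤ ∑ t ∈ Finset.Icc 1 𝒱.T, 𝒱.cost t * 𝒱.order π (𝒱.longest (𝒱.stoppedPath x n)) t := by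
    have e : ∀ s ∈ Finset.Icc 1 n, 𝒱.cost s * 𝒱.order π (𝒱.longest (𝒱.stoppedPath x 𝒱.T)) s =
        𝒱.cost s * 𝒱.order π (𝒱.longest (𝒱.stoppedPath x n)) s := by
      intro s hs
      rw [Finset.mem_Icc] at hs
      rw [𝒱.order_congr π fun r hr => ?_]
      simp only [longest, stoppedPath]
      rw [min_eq_left (by omega), min_eq_left (by omega)]
    rw [Finset.sum_congr rfl e]
    refine Finset.sum_le_sum_of_subset_of_nonneg (Finset.Icc_subset_Icc le_rfl hn2)
      fun t ht _ => ?_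
    rw [Finset.mem_Icc] at ht
    exact mul_nonneg (𝒱.cost_pos ht.1 ht.2).le (hfeas n hn1 hn2 t ht.1 ht.2).1
  have e : 𝒱.budget φ (𝒱.worstPath x n) =
    𝒱.p * 𝒱.worstPath x n - φ * 𝒱.hindsight (𝒱.worstPath x n) := rfl
  unfold profit planProfit at hk'
  linarith

theorem allPass_zero (𝒱 : RMOwP) : 𝒱.AllPass 0 := by
  intro h _ _
  rw [Passes, zero_mul, greedyGain_eq_sum]
  refine Finset.sum_nonneg fun t ht => ?_
  rw [Finset.mem_Icc] at ht
  exact mul_nonneg (sub_nonneg.2 (𝒱.cost_lt_p ht.1 ht.2).le) (𝒱.safeOrder_nonneg _ _ _ _)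

/-- The supremum is not known to be attained, so policies are only available for each `φ < Φ`. The
tests are closed conditions, continuous in `φ`, and survive the limit from the left. -/
theorem allPass_of_le_exactOptRatio (𝒱 : RMOwP) {Φ : ℝ} (hΦ : Φ ≤ 1)
    (h : (Φ : EReal) ≤ 𝒱.exactOptRatio) : 𝒱.AllPass (max Φ 0) := by
  rcases le_or_gt Φ 0 with h0 | h0
  · rw [max_eq_right h0]
    exact 𝒱.allPass_zero
  rw [max_eq_left h0.le]
  have key : ∀ φ, 0 ≤ φ → φ < Φ → 𝒱.AllPass φ := by
    intro φ hφ0 hφ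
    have hlt : (φ : EReal) < 𝒱.exactOptRatio := lt_of_lt_of_le (EReal.coe_lt_coe_iff.2 hφ) h
    obtain ⟨π, hπ⟩ := lt_iSup_iff.1 hlt
    obtain ⟨hf, hπ⟩ := lt_iSup_iff.1 hπ
    exact 𝒱.allPass_of_le_exactRobustRatio (hφ.le.trans hΦ) hf hπ.le
  intro x hx1 hx2
  have hc : ContinuousWithinAt (fun φ => 𝒱.greedyGain φ (𝒱.worstPath x) 𝒱.T) (Set.Iio Φ) Φ :=
    (𝒱.continuous_greedyGain _ _).continuousWithinAt
  have hc' : ContinuousWithinAt (fun φ => φ * 𝒱.hindsight x) (Set.Iio Φ) Φ := by fun_prop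
  refine le_of_tendsto_of_tendsto hc' hc ?_
  filter_upwards [Ioo_mem_nhdsLT h0] with φ hφ
  exact key φ hφ.1.le hφ.2 x hx1 hx2

theorem robustRatio_le_exactRobustRatio (𝒱 : RMOwP) (π : 𝒱.Policy) :
    𝒱.robustRatio π ≤ 𝒱.exactRobustRatio π :=
  le_iInf fun P => le_iInf fun d => le_iInf fun h =>
    (iInf_le _ P).trans ((iInf_le _ d).trans (iInf_le _ h.1))

theorem le_optRatio_of_allPass (𝒱 : RMOwP) {Φ : ℝ} (hΦ : Φ ≤ 1)
    (h : 𝒱.AllPass (max Φ 0)) : (Φ : EReal) ≤ 𝒱.optRatio :=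
  (𝒱.le_robustRatio_greedyPolicy hΦ h).trans
    (le_iSup₂ (f := fun π (_ : 𝒱.IsFeasible π) => 𝒱.robustRatio π) _
      (𝒱.isFeasible_greedyPolicy _))

theorem optRatio_le_exactOptRatio (𝒱 : RMOwP) : 𝒱.optRatio ≤ 𝒱.exactOptRatio :=
  iSup₂_mono fun π _ => 𝒱.robustRatio_le_exactRobustRatio π

/-! ### Finitely many critical sequences suffice -/

/-- `g` agrees with an affine function on `[a, b]`. -/
def AffineOnIcc (a b : ℝ) (g : ℝ → ℝ) : Prop := ∃ α β : ℝ, ∀ x ∈ Set.Icc a b, g x = α * x + β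

namespace AffineOnIcc

variable {a b : ℝ} {f g : ℝ → ℝ}

theorem const (c : ℝ) : AffineOnIcc a b fun _ => c := ⟨0, c, fun _ _ => by ring⟩

theorem sub_const (c : ℝ) : AffineOnIcc a b fun x => x - c := ⟨1, -c, fun _ _ => by ring⟩

theorem add (hf : AffineOnIcc a b f) (hg : AffineOnIcc a b g) :
    AffineOnIcc a b fun x => f x + g x := by
  obtain ⟨α, β, h⟩ := hf
  obtain ⟨α', β', h'⟩ := hg
  exact ⟨α + α', β + β', fun x hx => by simp only [h x hx, h' x hx]; ring⟩

theorem const_mul (c : ℝ) (hf : AffineOnIcc a b f) : AffineOnIcc a b fun x => c * f x := by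
  obtain ⟨α, β, h⟩ := hf
  exact ⟨c * α, c * β, fun x hx => by simp only [h x hx]; ring⟩

theorem sub (hf : AffineOnIcc a b f) (hg : AffineOnIcc a b g) :
    AffineOnIcc a b fun x => f x - g x := by
  obtain ⟨α, β, h⟩ := hf
  obtain ⟨α', β', h'⟩ := hg
  exact ⟨α - α', β - β', fun x hx => by simp only [h x hx, h' x hx]; ring⟩

theorem sum {ι : Type*} (s : Finset ι) {F : ι → ℝ → ℝ} (h : ∀ i ∈ s, AffineOnIcc a b (F i)) :
    AffineOnIcc a b fun x => ∑ i ∈ s, F i x := by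
  classical
  induction s using Finset.induction_on with
  | empty => simpa using const 0
  | insert i s hi ih =>
    simp only [Finset.sum_insert hi]
    exact (h i (Finset.mem_insert_self i s)).add
      (ih fun j hj => h j (Finset.mem_insert_of_mem hj))

theorem congr (hf : AffineOnIcc a b f) (h : ∀ x ∈ Set.Icc a b, g x = f x) :
    AffineOnIcc a b g := by
  obtain ⟨α, β, hf⟩ := hf
  exact ⟨α, β, fun x hx => (h x hx).trans (hf x hx)⟩

theorem concaveOn (hf : AffineOnIcc a b f) : ConcaveOn ℝ (Set.Icc a b) f := by
  obtain ⟨α, β, hf⟩ := hf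
  refine ⟨convex_Icc a b, fun x hx y hy s t hs ht hst => ?_⟩
  have hxy := convex_Icc a b hx hy hs ht hst
  rw [hf x hx, hf y hy, hf _ hxy]
  simp only [smul_eq_mul]
  have : β = (s + t) * β := by rw [hst, one_mul]
  linarith

end AffineOnIcc

/-- Between the nearest projected breakpoints or end points on either side of `x` there is no
further breakpoint; a concave function on that piece is at least the smaller of its two end values.
-/
theorem nonneg_of_concaveOn_pieces (Z : Finset ℝ) {D : ℝ → ℝ} {lo hi : ℝ}
    (hD : ∀ a b, lo ≤ a → a ≤ b → b ≤ hi → (∀ z ∈ Z, z ≤ a ∨ b ≤ z) →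
      ConcaveOn ℝ (Set.Icc a b) D)
    (hZ : ∀ z ∈ Z, 0 ≤ D (min (max z lo) hi)) (hlo : 0 ≤ D lo) (hhi : 0 ≤ D hi)
    {x : ℝ} (hx : x ∈ Set.Icc lo hi) : 0 ≤ D x := by
  have hlh := hx.1.trans hx.2
  set S : Finset ℝ := insert lo (insert hi (Z.image fun z => min (max z lo) hi)) with hS
  have hS0 : ∀ y ∈ S, 0 ≤ D y := by
    intro y hy
    simp only [hS, Finset.mem_insert, Finset.mem_image] at hy
    obtain rfl | rfl | ⟨z, hz, rfl⟩ := hy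
    exacts [hlo, hhi, hZ z hz]
  have hSI : ∀ y ∈ S, y ∈ Set.Icc lo hi := by
    intro y hy
    simp only [hS, Finset.mem_insert, Finset.mem_image] at hy
    obtain rfl | rfl | ⟨z, hz, rfl⟩ := hy
    exacts [⟨le_rfl, hlh⟩, ⟨hlh, le_rfl⟩, ⟨le_min (le_max_right _ _) hlh, min_le_right _ _⟩]
  have hA : (S.filter (· ≤ x)).Nonempty := ⟨lo, by simp [hS, hx.1]⟩
  have hB : (S.filter (x ≤ ·)).Nonempty := ⟨hi, by simp [hS, hx.2]⟩
  have ha := Finset.mem_filter.1 ((S.filter (· ≤ x)).max'_mem hA)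
  have hb := Finset.mem_filter.1 ((S.filter (x ≤ ·)).min'_mem hB)
  set a := (S.filter (· ≤ x)).max' hA with hadef
  set b := (S.filter (x ≤ ·)).min' hB with hbdef
  have hcon : ConcaveOn ℝ (Set.Icc a b) D := by
    refine hD a b (hSI a ha.1).1 (ha.2.trans hb.2) (hSI b hb.1).2 fun z hz => ?_
    have hzS : min (max z lo) hi ∈ S := by
      simp only [hS, Finset.mem_insert, Finset.mem_image]
      exact Or.inr (Or.inr ⟨z, hz, rfl⟩)
    rcases le_total (min (max z lo) hi) x with h | h
    · have h1 : min (max z lo) hi ≤ a := Finset.le_max' _ _ (Finset.mem_filter.2 ⟨hzS, h⟩)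
      rcases le_total z hi with h2 | h2
      · left
        rw [min_eq_left (max_le h2 hlh)] at h1
        exact (le_max_left _ _).trans h1
      · exact Or.inr ((hSI b hb.1).2.trans h2)
    · have h1 : b ≤ min (max z lo) hi := Finset.min'_le _ _ (Finset.mem_filter.2 ⟨hzS, h⟩)
      rcases le_total lo z with h2 | h2
      · rw [max_eq_left h2] at h1
        exact Or.inr (h1.trans (min_le_left _ _))
      · left
        exact h2.trans (hSI a ha.1).1
  have := hcon.min_le_of_mem_Icc (x := a) (y := b) (z := x) ⟨le_rfl, ha.2.trans hb.2⟩
    ⟨ha.2.trans hb.2, le_rfl⟩ ⟨ha.2, hb.2⟩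
  exact (le_min (hS0 a ha.1) (hS0 b hb.1)).trans this


/-- The total capacity of the days before day `t`. -/
def capacityBefore (𝒱 : RMOwP) (t : ℕ) : ℝ := ∑ i ∈ Finset.Ico 1 t, 𝒱.V i

theorem capacityBefore_one (𝒱 : RMOwP) : 𝒱.capacityBefore 1 = 0 := by simp [capacityBefore]

theorem capacityBefore_succ (𝒱 : RMOwP) {t : ℕ} (ht : 1 ≤ t) :
    𝒱.capacityBefore (t + 1) = 𝒱.capacityBefore t + 𝒱.V t :=
  Finset.sum_Ico_succ_top ht _

/-- The distances at which breakpoints of the budget reappear along critical sequences. -/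
def shift (𝒱 : RMOwP) (k : ℕ) : ℝ := if k = 0 then 0 else 𝒱.Δ k

/-- Projection onto the possible upper prediction bounds of day `T`. -/
def clamp (𝒱 : RMOwP) (h : ℝ) : ℝ := min (max h (𝒱.dlo + 𝒱.Δ 𝒱.T)) 𝒱.dhi

/-- On an interval free of breakpoints, each day's hindsight order is zero, at full capacity, or
equal to the remaining demand throughout. The kinks of day `t` are the capacities before `t` and
before `t + 1`, hence the range up to `T + 1`. -/
theorem affineOnIcc_hindsight (𝒱 : RMOwP) {a b δ : ℝ}
    (h : ∀ t, 1 ≤ t → t ≤ 𝒱.T + 1 →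
      𝒱.capacityBefore t + δ ≤ a ∨ b ≤ 𝒱.capacityBefore t + δ) :
    AffineOnIcc a b fun x => 𝒱.hindsight (x - δ) := by
  unfold hindsight
  refine AffineOnIcc.sum _ fun t ht => AffineOnIcc.const_mul _ ?_
  rw [Finset.mem_Icc] at ht
  have hV := 𝒱.V_nonneg t ht.1 ht.2
  have hs := 𝒱.capacityBefore_succ ht.1
  change AffineOnIcc a b fun x => min (𝒱.V t) (max (x - δ - 𝒱.capacityBefore t) 0)
  rcases h t ht.1 (by omega) with h1 | h1
  · rcases h (t + 1) (by omega) (by omega) with h2 | h2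
    · refine (AffineOnIcc.const (𝒱.V t)).congr fun x hx => ?_
      have := hx.1
      rw [max_eq_left (by linarith), min_eq_left (by linarith)]
    · refine (AffineOnIcc.sub_const (δ + 𝒱.capacityBefore t)).congr fun x hx => ?_
      have := hx.1
      have := hx.2
      rw [max_eq_left (by linarith), min_eq_right (by linarith)]
      ring
  · refine (AffineOnIcc.const 0).congr fun x hx => ?_
    have := hx.2
    rw [max_eq_right (by linarith), min_eq_right hV]

theorem affineOnIcc_budget_worstPath (𝒱 : RMOwP) (φ : ℝ) {a b : ℝ} {t : ℕ}
    (h0 : 𝒱.dlo + 𝒱.Δ t ≤ a ∨ b ≤ 𝒱.dlo + 𝒱.Δ t)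
    (h : ∀ s, 1 ≤ s → s ≤ 𝒱.T + 1 →
      𝒱.capacityBefore s + 𝒱.Δ t ≤ a ∨ b ≤ 𝒱.capacityBefore s + 𝒱.Δ t) :
    AffineOnIcc a b fun x => 𝒱.budget φ (𝒱.worstPath x t) := by
  rcases h0 with h0 | h0
  · refine (((AffineOnIcc.sub_const (𝒱.Δ t)).const_mul 𝒱.p).sub
      ((𝒱.affineOnIcc_hindsight h).const_mul φ)).congr fun x hx => ?_
    have := hx.1
    rw [worstPath, max_eq_left (by linarith), budget]
  · refine (AffineOnIcc.const (𝒱.budget φ 𝒱.dlo)).congr fun x hx => ?_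
    have := hx.2
    rw [worstPath, max_eq_right (by linarith)]

/-- By induction, the spending is the minimum of an affine function and a shifted concave one. -/
theorem concaveOn_greedySpend (𝒱 : RMOwP) {φ : ℝ} (hφ : φ ≤ 1) {a b : ℝ}
    (h : ∀ t, 1 ≤ t → t ≤ 𝒱.T → AffineOnIcc a b fun x => 𝒱.budget φ (𝒱.worstPath x t)) {n : ℕ}
    (hn : n ≤ 𝒱.T) : ConcaveOn ℝ (Set.Icc a b) fun x => 𝒱.greedySpend φ (𝒱.worstPath x) n := by
  induction n with
  | zero => exact concaveOn_const 0 (convex_Icc a b)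
  | succ n ih =>
    simp only [fun x => (𝒱.greedySpend_le_and_succ hφ (𝒱.isLowerPath_worstPath x) hn).2]
    exact (h (n + 1) (by omega) hn).concaveOn.inf ((ih (by omega)).add_const _)

theorem concaveOn_greedyGain (𝒱 : RMOwP) {φ : ℝ} (hφ : φ ≤ 1) {a b : ℝ}
    (h : ∀ t, 1 ≤ t → t ≤ 𝒱.T → AffineOnIcc a b fun x => 𝒱.budget φ (𝒱.worstPath x t)) :
    ConcaveOn ℝ (Set.Icc a b) fun x => 𝒱.greedyGain φ (𝒱.worstPath x) 𝒱.T := by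
  -- Abel summation again: with `ρ` the rate of the new day, `gain (n+1) - q spend (n+1)` equals
  -- `(gain n - ρ spend n) + (ρ - q) spend (n+1)`, and `ρ - q ≥ 0`.
  have main : ∀ n, n ≤ 𝒱.T → ∀ q : ℝ, (∀ s, 1 ≤ s → s ≤ n → q ≤ 𝒱.p / 𝒱.cost s - 1) →
      ConcaveOn ℝ (Set.Icc a b) fun x =>
        𝒱.greedyGain φ (𝒱.worstPath x) n - q * 𝒱.greedySpend φ (𝒱.worstPath x) n := by
    intro n
    induction n with
    | zero =>
      intro _ q _
      simpa only [greedyGain, greedySpend] using concaveOn_const (0 - q * 0) (convex_Icc a b)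
    | succ n ih =>
      intro hn q hq
      have hc := 𝒱.cost_pos (t := n + 1) (by omega) hn
      have h1 := ih (by omega) (𝒱.p / 𝒱.cost (n + 1) - 1) (fun s h h' => by
        have := 𝒱.cost_mono h (show s ≤ n + 1 by omega) hn
        have := div_le_div_of_nonneg_left 𝒱.p_pos.le (𝒱.cost_pos h (by omega)) this
        linarith)
      have h2 := (𝒱.concaveOn_greedySpend hφ h hn).smul
        (sub_nonneg.2 (hq (n + 1) (by omega) le_rfl))
      refine (h1.add h2).congr fun x _ => ?_
      simp only [smul_eq_mul, greedyGain, greedySpend, Pi.add_apply]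
      field_simp
      ring
  simpa using main 𝒱.T le_rfl 0 (fun s h h' => by
    have := (one_le_div (𝒱.cost_pos h h')).2 (𝒱.cost_lt_p h h').le
    linarith)

theorem clamp_mem (𝒱 : RMOwP) (x : ℝ) :
    𝒱.dlo + 𝒱.Δ 𝒱.T ≤ 𝒱.clamp x ∧ 𝒱.clamp x ≤ 𝒱.dhi :=
  ⟨le_min (le_max_right _ _) (𝒱.dlo_add_Δ_le 𝒱.one_le_T le_rfl), min_le_right _ _⟩

/-- The finite test: only demands at which a breakpoint occurs have to be examined. -/
theorem allPass_iff (𝒱 : RMOwP) {φ : ℝ} (hφ : φ ≤ 1) :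
    𝒱.AllPass φ ↔
      (∀ k ≤ 𝒱.T, 𝒱.Passes φ (𝒱.clamp (𝒱.dhi + 𝒱.shift k))) ∧
      (∀ k ≤ 𝒱.T, 𝒱.Passes φ (𝒱.clamp (𝒱.dlo + 𝒱.shift k))) ∧
      ∀ s, 1 ≤ s → s ≤ 𝒱.T + 1 → ∀ k ≤ 𝒱.T,
        𝒱.Passes φ (𝒱.clamp (𝒱.capacityBefore s + 𝒱.shift k)) := by
  constructor
  · intro h
    have h' : ∀ x, 𝒱.Passes φ (𝒱.clamp x) := fun x => h _ (𝒱.clamp_mem x).1 (𝒱.clamp_mem x).2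
    exact ⟨fun _ _ => h' _, fun _ _ => h' _, fun _ _ _ _ _ => h' _⟩
  · rintro ⟨h1, h2, h3⟩ x hx1 hx2
    have hT := 𝒱.one_le_T
    have hdlo := 𝒱.dlo_add_Δ_le hT le_rfl
    rw [Passes, ← sub_nonneg]
    refine nonneg_of_concaveOn_pieces
      (Finset.image₂ (· + ·) (insert 𝒱.dlo ((Finset.Icc 1 (𝒱.T + 1)).image 𝒱.capacityBefore))
        ((Finset.range (𝒱.T + 1)).image 𝒱.shift))
      (D := fun x => 𝒱.greedyGain φ (𝒱.worstPath x) 𝒱.T - φ * 𝒱.hindsight x)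
      (lo := 𝒱.dlo + 𝒱.Δ 𝒱.T) (hi := 𝒱.dhi) ?_ ?_ ?_ ?_ ⟨hx1, hx2⟩
    · intro a b _ _ _ hZ
      have hW : ∀ k ≤ 𝒱.T, ∀ s, 1 ≤ s → s ≤ 𝒱.T + 1 →
          𝒱.capacityBefore s + 𝒱.shift k ≤ a ∨ b ≤ 𝒱.capacityBefore s + 𝒱.shift k :=
        fun k hk s hs1 hs2 => hZ _ (Finset.mem_image₂_of_mem
          (Finset.mem_insert_of_mem (Finset.mem_image_of_mem _ (Finset.mem_Icc.2 ⟨hs1, hs2⟩)))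
          (Finset.mem_image_of_mem _ (Finset.mem_range.2 (by omega))))
      have hd : ∀ k ≤ 𝒱.T, 𝒱.dlo + 𝒱.shift k ≤ a ∨ b ≤ 𝒱.dlo + 𝒱.shift k :=
        fun k hk => hZ _ (Finset.mem_image₂_of_mem (Finset.mem_insert_self _ _)
          (Finset.mem_image_of_mem _ (Finset.mem_range.2 (by omega))))
      have hsh : ∀ k, 1 ≤ k → 𝒱.shift k = 𝒱.Δ k := fun k hk => if_neg (by omega)
      -- Shift `0` supplies the kinks of the hindsight profit at `h` itself; shift `t ≥ 1` those of
      -- the budget at `h - Δ t`.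
      have hf := ((𝒱.affineOnIcc_hindsight (hW 0 (by omega))).const_mul (-φ)).concaveOn
      have hg := 𝒱.concaveOn_greedyGain hφ (a := a) (b := b) fun t ht1 ht2 =>
        𝒱.affineOnIcc_budget_worstPath φ (hsh t ht1 ▸ hd t ht2) (hsh t ht1 ▸ hW t ht2)
      refine (hg.add hf).congr fun x _ => ?_
      simp only [Pi.add_apply, shift, if_true, sub_zero]
      ring
    · intro z hz
      obtain ⟨x, hx, y, hy, rfl⟩ := Finset.mem_image₂.1 hz
      obtain ⟨k, hk, rfl⟩ := Finset.mem_image.1 hy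
      have hk : k ≤ 𝒱.T := by have := Finset.mem_range.1 hk; omega
      rcases Finset.mem_insert.1 hx with rfl | hx
      · exact sub_nonneg.2 (h2 k hk)
      · obtain ⟨s, hs, rfl⟩ := Finset.mem_image.1 hx
        rw [Finset.mem_Icc] at hs
        exact sub_nonneg.2 (h3 s hs.1 hs.2 k hk)
    -- The lower end of the range is `dlo` shifted by `Δ T`, the upper end is `dhi` with shift `0`.
    -- The other shifts of `dhi` merely let the program use one loop for all kinds of tests.
    · have := h2 𝒱.T le_rfl
      rw [shift, if_neg (by omega), clamp, max_self, min_eq_left hdlo] at this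
      exact sub_nonneg.2 this
    · have := h1 0 (by omega)
      rw [shift, if_pos rfl, add_zero, clamp, max_eq_left hdlo, min_self] at this
      exact sub_nonneg.2 this

end RMOwP

/-! ### Registers of the real RAM

Below, a memory is split into a read-only part, the cells of the input, and registers: the
natural-number register `i` is the cell with address `K + 3 + i`, where `K` is the content of the
natural-number cell `1`; the real register `i` is the cell with address `M + i`, where `M` is the
content of the natural-number register `1`. -/
namespace RealRAM

/-- The address of a natural-number register. -/
def natReg (i : ℕ) : NExp := .add (.add (.get (.lit 1)) (.lit 3)) (.lit i)

/-- The content of a natural-number register. -/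
def natVar (i : ℕ) : NExp := .get (natReg i)

/-- The address of a real register. -/
def realReg (i : ℕ) : NExp := .add (natVar 1) (.lit i)

/-- The content of a real register. -/
def realVar (i : ℕ) : RExp := .get (realReg i)

def setNat (i : ℕ) (e : NExp) : Cmd := .natSet (natReg i) e

def setReal (i : ℕ) (e : RExp) : Cmd := .realSet (realReg i) e

/-- Raise a real register to the value of `e` if it is smaller. -/
def raiseReal (i : ℕ) (e : RExp) : Cmd := .ite (.realLE (realVar i) e) (setReal i e) .skip

/-- Lower a real register to the value of `e` if it is larger. -/
def lowerReal (i : ℕ) (e : RExp) : Cmd := .ite (.realLE e (realVar i)) (setReal i e) .skip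

/-- The memory with read-only part taken from `β` and registers `n` and `r`. -/
def Mem.withRegs (β : Mem) (n : ℕ → ℕ) (r : ℕ → ℝ) : Mem where
  nat j := if j < β.nat 1 + 3 then β.nat j else n (j - (β.nat 1 + 3))
  real j := if j < n 1 then β.real j else r (j - n 1)

theorem Mem.eq_withRegs (σ : Mem) {M : ℕ} (hM : σ.nat (σ.nat 1 + 3 + 1) = M) :
    σ = σ.withRegs (fun i => σ.nat (σ.nat 1 + 3 + i)) (fun i => σ.real (M + i)) := by
  subst hM
  rcases σ with ⟨f, g⟩
  simp only [withRegs, Mem.mk.injEq]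
  constructor <;> funext j <;> split_ifs with h
  · rfl
  · rw [Nat.add_sub_cancel' (not_lt.1 h)]
  · rfl
  · rw [Nat.add_sub_cancel' (not_lt.1 h)]

section Eval

variable (β : Mem) (n : ℕ → ℕ) (r : ℕ → ℝ) (i : ℕ)

theorem Mem.withRegs_nat_of_lt {j : ℕ} (hj : j < β.nat 1 + 3) :
    (β.withRegs n r).nat j = β.nat j := if_pos hj

theorem Mem.withRegs_real_of_lt {j : ℕ} (hj : j < n 1) :
    (β.withRegs n r).real j = β.real j := if_pos hj

@[simp] theorem Mem.withRegs_nat_one : (β.withRegs n r).nat 1 = β.nat 1 :=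
  β.withRegs_nat_of_lt n r (by omega)

@[simp] theorem Mem.withRegs_nat_reg : (β.withRegs n r).nat (β.nat 1 + 3 + i) = n i := by
  simp [withRegs]

@[simp] theorem Mem.withRegs_real_reg : (β.withRegs n r).real (n 1 + i) = r i := by
  simp [withRegs]

@[simp] theorem natReg_eval : (natReg i).eval (β.withRegs n r) = β.nat 1 + 3 + i := by
  simp [natReg, NExp.eval]

@[simp] theorem natVar_eval : (natVar i).eval (β.withRegs n r) = n i := by
  simp [natVar, NExp.eval]

@[simp] theorem realReg_eval : (realReg i).eval (β.withRegs n r) = n 1 + i := by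
  simp [realReg, NExp.eval]

@[simp] theorem realVar_eval : (realVar i).eval (β.withRegs n r) = r i := by
  simp [realVar, RExp.eval]

/-- Register `1` is excluded because it holds the base address of the real registers; changing it
would move them all. -/
theorem Mem.withRegs_update_nat (hi : i ≠ 1) (v : ℕ) :
    (⟨Function.update (β.withRegs n r).nat (β.nat 1 + 3 + i) v, (β.withRegs n r).real⟩ : Mem) =
      β.withRegs (Function.update n i v) r := by
  simp only [withRegs, Mem.mk.injEq, Function.update_of_ne hi.symm, and_true]
  funext j
  by_cases h : j < β.nat 1 + 3
  · rw [Function.update_of_ne (by omega), if_pos h, if_pos h]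
  · rw [if_neg h]
    by_cases h' : j = β.nat 1 + 3 + i
    · subst h'
      simp
    · rw [Function.update_of_ne h', if_neg h, Function.update_of_ne (by omega)]

theorem Mem.withRegs_update_real (v : ℝ) :
    (⟨(β.withRegs n r).nat, Function.update (β.withRegs n r).real (n 1 + i) v⟩ : Mem) =
      β.withRegs n (Function.update r i v) := by
  simp only [withRegs, Mem.mk.injEq, true_and]
  funext j
  by_cases h : j < n 1
  · rw [Function.update_of_ne (by omega), if_pos h, if_pos h]
  · rw [if_neg h]
    by_cases h' : j = n 1 + i
    · subst h'
      simp
    · rw [Function.update_of_ne h', if_neg h, Function.update_of_ne (by omega)]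

end Eval

@[simp] theorem natReg_cost (i : ℕ) : (natReg i).cost = 6 := rfl
@[simp] theorem natVar_cost (i : ℕ) : (natVar i).cost = 7 := rfl
@[simp] theorem realReg_cost (i : ℕ) : (realReg i).cost = 9 := rfl
@[simp] theorem realVar_cost (i : ℕ) : (realVar i).cost = 10 := rfl

/-- Started with read-only memory `β` and registers `n`, `r`, the program `c` halts after at most
`N` steps with the same read-only memory and registers that satisfy `Q`. -/
def Reaches (β : Mem) (c : Cmd) (n : ℕ → ℕ) (r : ℕ → ℝ) (N : ℕ)
    (Q : (ℕ → ℕ) → (ℕ → ℝ) → Prop) : Prop :=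
  ∃ n' r' m, Exec c (β.withRegs n r) (β.withRegs n' r') m ∧ m ≤ N ∧ Q n' r'

/-! ### Total-correctness rules with time bounds -/

namespace Reaches

variable {β : Mem} {c c₁ c₂ : Cmd} {n : ℕ → ℕ} {r : ℕ → ℝ} {N N' N₁ N₂ : ℕ}
  {Q Q' : (ℕ → ℕ) → (ℕ → ℝ) → Prop}

theorem mono (h : Reaches β c n r N Q) (hN : N ≤ N') (hQ : ∀ n' r', Q n' r' → Q' n' r') :
    Reaches β c n r N' Q' := by
  obtain ⟨n', r', m, h1, h2, h3⟩ := h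
  exact ⟨n', r', m, h1, h2.trans hN, hQ _ _ h3⟩

theorem mono_time (h : Reaches β c n r N Q) (hN : N ≤ N') : Reaches β c n r N' Q :=
  h.mono hN fun _ _ => id

theorem skip (h : Q n r) : Reaches β .skip n r 1 Q := ⟨n, r, 1, .skip _, le_rfl, h⟩

theorem setNat {i : ℕ} {e : NExp} {v : ℕ} (hi : i ≠ 1) (he : e.eval (β.withRegs n r) = v)
    (h : Q (Function.update n i v) r) : Reaches β (setNat i e) n r (7 + e.cost) Q := by
  have := Exec.natSet (natReg i) e (β.withRegs n r)
  rw [natReg_eval, Mem.withRegs_update_nat _ _ _ _ hi, he, natReg_cost] at this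
  exact ⟨_, _, _, this, by omega, h⟩

theorem setReal {i : ℕ} {e : RExp} {v : ℝ} (he : e.eval (β.withRegs n r) = v)
    (h : Q n (Function.update r i v)) : Reaches β (setReal i e) n r (10 + e.cost) Q := by
  have := Exec.realSet (realReg i) e (β.withRegs n r)
  rw [realReg_eval, Mem.withRegs_update_real, he, realReg_cost] at this
  exact ⟨_, _, _, this, by omega, h⟩

theorem ite {b : BExp} (h₁ : b.eval (β.withRegs n r) → Reaches β c₁ n r N₁ Q)
    (h₂ : ¬ b.eval (β.withRegs n r) → Reaches β c₂ n r N₂ Q) :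
    Reaches β (.ite b c₁ c₂) n r (b.cost + N₁ + N₂ + 1) Q := by
  by_cases hb : b.eval (β.withRegs n r)
  · obtain ⟨n', r', m, h1, h2, h3⟩ := h₁ hb
    exact ⟨n', r', _, .iteTrue hb h1, by omega, h3⟩
  · obtain ⟨n', r', m, h1, h2, h3⟩ := h₂ hb
    exact ⟨n', r', _, .iteFalse hb h1, by omega, h3⟩

theorem raiseReal {i : ℕ} {e : RExp} {v : ℝ} (he : e.eval (β.withRegs n r) = v)
    (h : Q n (Function.update r i (max (r i) v))) :
    Reaches β (raiseReal i e) n r (2 * e.cost + 23) Q := by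
  refine mono_time (ite (fun hb => setReal he ?_) fun hb => skip ?_) ?_
  · simp only [BExp.eval, realVar_eval, he] at hb
    rwa [max_eq_right hb] at h
  · simp only [BExp.eval, realVar_eval, he, not_le] at hb
    rwa [max_eq_left hb.le, Function.update_eq_self] at h
  · simp only [BExp.cost, realVar_cost]
    omega

theorem lowerReal {i : ℕ} {e : RExp} {v : ℝ} (he : e.eval (β.withRegs n r) = v)
    (h : Q n (Function.update r i (min (r i) v))) :
    Reaches β (lowerReal i e) n r (2 * e.cost + 23) Q := by
  refine mono_time (ite (fun hb => setReal he ?_) fun hb => skip ?_) ?_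
  · simp only [BExp.eval, realVar_eval, he] at hb
    rwa [min_eq_right hb] at h
  · simp only [BExp.eval, realVar_eval, he, not_le] at hb
    rwa [min_eq_left hb.le, Function.update_eq_self] at h
  · simp only [BExp.cost, realVar_cost]
    omega

theorem seq (h₁ : Reaches β c₁ n r N₁ Q') (h₂ : ∀ n' r', Q' n' r' → Reaches β c₂ n' r' N₂ Q) :
    Reaches β (.seq c₁ c₂) n r (N₁ + N₂) Q := by
  obtain ⟨n', r', m, h1, h2, h3⟩ := h₁
  obtain ⟨n'', r'', m', h1', h2', h3'⟩ := h₂ n' r' h3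
  exact ⟨n'', r'', _, .seq h1 h1', by omega, h3'⟩

theorem setNat_seq {i : ℕ} {e : NExp} (v : ℕ) (hi : i ≠ 1)
    (he : e.eval (β.withRegs n r) = v) (h : Reaches β c (Function.update n i v) r N Q) :
    Reaches β (.seq (RealRAM.setNat i e) c) n r (7 + e.cost + N) Q :=
  seq (Q' := fun n' r' => n' = Function.update n i v ∧ r' = r) (setNat hi he ⟨rfl, rfl⟩)
    (by rintro _ _ ⟨rfl, rfl⟩; exact h)

theorem setReal_seq {i : ℕ} {e : RExp} (v : ℝ)
    (he : e.eval (β.withRegs n r) = v) (h : Reaches β c n (Function.update r i v) N Q) :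
    Reaches β (.seq (RealRAM.setReal i e) c) n r (10 + e.cost + N) Q :=
  seq (Q' := fun n' r' => n' = n ∧ r' = Function.update r i v) (setReal he ⟨rfl, rfl⟩)
    (by rintro _ _ ⟨rfl, rfl⟩; exact h)

theorem raiseReal_seq {i : ℕ} {e : RExp} (v : ℝ) (he : e.eval (β.withRegs n r) = v)
    (h : Reaches β c n (Function.update r i (max (r i) v)) N Q) :
    Reaches β (.seq (RealRAM.raiseReal i e) c) n r (2 * e.cost + 23 + N) Q :=
  seq (Q' := fun n' r' => n' = n ∧ r' = Function.update r i (max (r i) v))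
    (raiseReal he ⟨rfl, rfl⟩) (by rintro _ _ ⟨rfl, rfl⟩; exact h)

theorem lowerReal_seq {i : ℕ} {e : RExp} (v : ℝ) (he : e.eval (β.withRegs n r) = v)
    (h : Reaches β c n (Function.update r i (min (r i) v)) N Q) :
    Reaches β (.seq (RealRAM.lowerReal i e) c) n r (2 * e.cost + 23 + N) Q :=
  seq (Q' := fun n' r' => n' = n ∧ r' = Function.update r i (min (r i) v))
    (lowerReal he ⟨rfl, rfl⟩) (by rintro _ _ ⟨rfl, rfl⟩; exact h)

/-- A loop with invariant `Inv` that is left after exactly `M` iterations. -/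
theorem loop {b : BExp} (Inv : ℕ → (ℕ → ℕ) → (ℕ → ℝ) → Prop) (M : ℕ) (h₀ : Inv 0 n r)
    (step : ∀ k < M, ∀ n r, Inv k n r →
      b.eval (β.withRegs n r) ∧ Reaches β c n r N (Inv (k + 1)))
    (exit : ∀ n r, Inv M n r → ¬ b.eval (β.withRegs n r)) :
    Reaches β (.loop b c) n r (M * (N + b.cost + 1) + (b.cost + 1)) (Inv M) := by
  -- Induction on the number `j` of iterations still to come.
  have main : ∀ j k n r, k + j = M → Inv k n r →
      Reaches β (.loop b c) n r (j * (N + b.cost + 1) + (b.cost + 1)) (Inv M) := by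
    intro j
    induction j with
    | zero =>
      rintro k n r rfl h
      exact ⟨n, r, _, .loopStop (exit n r h), by omega, h⟩
    | succ j ih =>
      intro k n r hk h
      obtain ⟨hb, n', r', m, h1, h2, h3⟩ := step k (by omega) n r h
      obtain ⟨n'', r'', m', h1', h2', h3'⟩ := ih (k + 1) n' r' (by omega) h3
      refine ⟨n'', r'', _, .loopStep hb h1 h1', ?_, h3'⟩
      rw [Nat.succ_mul]
      omega
  exact main M 0 n r (by omega) h₀

end Reaches

/-- `f` and `g` agree except on `s`. -/
def EqOff {α : Type*} (s : List ℕ) (f g : ℕ → α) : Prop := ∀ i, i ∉ s → f i = g i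

namespace EqOff

variable {α : Type*} {s t u : List ℕ} {f g h : ℕ → α}

theorem refl (s : List ℕ) (f : ℕ → α) : EqOff s f f := fun _ _ => rfl

theorem trans (h₁ : EqOff s f g) (h₂ : EqOff t g h) (hs : s ⊆ u) (ht : t ⊆ u) : EqOff u f h :=
  fun i hi => (h₁ i fun h => hi (hs h)).trans (h₂ i fun h => hi (ht h))

theorem update (h : EqOff s f g) {i : ℕ} (hi : i ∈ s) (v : α) :
    EqOff s (Function.update f i v) g := fun j hj => by
  rw [Function.update_of_ne (by rintro rfl; exact hj hi)]
  exact h j hj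

theorem mono (h : EqOff s f g) (hs : s ⊆ u) : EqOff u f g := fun i hi => h i fun h => hi (hs h)

end EqOff

end RealRAM

/-! ### The programs -/
namespace RealRAM

/-- The capacity of the day in natural-number register `j`. -/
def capacityCell (j : ℕ) : RExp := .get (.add (.add (natVar 0) (natVar j)) (.lit 3))

/-- The prediction error bound of the day in natural-number register `j`. -/
def errorCell (j : ℕ) : RExp := .get (.add (natVar j) (.lit 3))

/-- The unit ordering cost of the phase in natural-number register `3`. -/
def phaseCostCell : RExp :=
  .get (.add (.add (.add (natVar 0) (natVar 0)) (.lit 4)) (natVar 3))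

/-- Write the unit ordering cost of the day in natural-number register `j` into real register
`5`. -/
def costCmd (j : ℕ) : Cmd :=
  .seq (setReal 5 (.lit 0)) <| .seq (setNat 3 (.lit 0)) <|
  .loop (.natLE (.add (natVar 3) (.lit 1)) (.get (.lit 1))) <|
    .seq (.ite (.both (.natLE (.get (.add (natVar 3) (.lit 2))) (natVar j))
        (.natLE (.add (natVar j) (.lit 1)) (.get (.add (natVar 3) (.lit 3)))))
      (setReal 5 (.add (realVar 5) phaseCostCell)) .skip)
    (setNat 3 (.add (natVar 3) (.lit 1)))

/-- Write the hindsight optimal profit for the demand in real register `2` into real register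
`3`. -/
def hindsightCmd : Cmd :=
  .seq (setReal 3 (.lit 0)) <| .seq (setReal 4 (.lit 0)) <| .seq (setNat 2 (.lit 1)) <|
  .loop (.natLE (natVar 2) (natVar 0)) <|
    .seq (costCmd 2) <|
    .seq (setReal 6 (.sub (realVar 2) (realVar 4))) <|
    .seq (raiseReal 6 (.lit 0)) <|
    .seq (lowerReal 6 (capacityCell 2)) <|
    .seq (setReal 3 (.add (realVar 3) (.mul (.sub (realVar 0) (realVar 5)) (realVar 6)))) <|
    .seq (setReal 4 (.add (realVar 4) (capacityCell 2))) <|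
    setNat 2 (.add (natVar 2) (.lit 1))

/-- Write the safe order of the day in natural-number register `7` into real register `12`, where
real register `2` contains the lower prediction bound and real register `9` the total ordering cost
up to now.  Real register `5` receives the unit ordering cost of the day. -/
def orderCmd : Cmd :=
  .seq hindsightCmd <| .seq (costCmd 7) <|
  .seq (setReal 12 (.div (.sub (.sub (.mul (realVar 0) (realVar 2))
    (.mul (realVar 1) (realVar 3))) (realVar 9)) (realVar 5))) <|
  .seq (lowerReal 12 (capacityCell 7)) <|
  raiseReal 12 (.lit 0)

/-- Clear the flag in natural-number register `4` unless the critical sequence for the demand in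
real register `8` is passed. -/
def passCmd : Cmd :=
  .seq (setReal 9 (.lit 0)) <| .seq (setReal 10 (.lit 0)) <| .seq (setNat 7 (.lit 1)) <|
  .seq (.loop (.natLE (natVar 7) (natVar 0)) <|
    .seq (setReal 2 (.sub (realVar 8) (errorCell 7))) <|
    .seq (raiseReal 2 (.get (.lit 0))) <|
    .seq orderCmd <|
    .seq (setReal 9 (.add (realVar 9) (.mul (realVar 5) (realVar 12)))) <|
    .seq (setReal 10 (.add (realVar 10)
      (.mul (.sub (realVar 0) (realVar 5)) (realVar 12)))) <|
    setNat 7 (.add (natVar 7) (.lit 1))) <|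
  .seq (setReal 2 (realVar 8)) <| .seq hindsightCmd <|
  .ite (.realLE (.mul (realVar 1) (realVar 3)) (realVar 10)) .skip (setNat 4 (.lit 0))

/-- Perform the test `passCmd` for all shifts of the demand in real register `7`. -/
def shiftsCmd : Cmd :=
  .seq (setNat 6 (.lit 0)) <|
  .loop (.natLE (natVar 6) (natVar 0)) <|
    .seq (setReal 8 (.add (realVar 7) (errorCell 6))) <|
    .seq (raiseReal 8 (.add (.get (.lit 0)) (.get (.add (natVar 0) (.lit 3))))) <|
    .seq (lowerReal 8 (.get (.lit 1))) <|
    .seq passCmd <|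
    setNat 6 (.add (natVar 6) (.lit 1))

/-- Perform all tests. -/
def testsCmd : Cmd :=
  .seq (setNat 4 (.lit 1)) <|
  .seq (setReal 7 (.get (.lit 1))) <| .seq shiftsCmd <|
  .seq (setReal 7 (.get (.lit 0))) <| .seq shiftsCmd <|
  .seq (setReal 7 (.lit 0)) <| .seq shiftsCmd <|
  .seq (setNat 5 (.lit 1)) <|
  .loop (.natLE (natVar 5) (natVar 0)) <|
    .seq (setReal 7 (.add (realVar 7) (capacityCell 5))) <|
    .seq shiftsCmd <|
    setNat 5 (.add (natVar 5) (.lit 1))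

/-- Write the total ordering cost of the inventory vector into real register `9`. -/
def spendCmd : Cmd :=
  .seq (setReal 9 (.lit 0)) <| .seq (setNat 3 (.lit 0)) <|
  .loop (.natLE (.add (natVar 3) (.lit 1)) (.get (.lit 1))) <|
    .seq (setReal 9 (.add (realVar 9)
      (.mul phaseCostCell (.get (.add (natVar 3) (.lit 2)))))) <|
    setNat 3 (.add (natVar 3) (.lit 1))

end RealRAM

namespace RMOwP

open RealRAM

/-- A strictly increasing integer grid from `1` to `T + 1` has at most `T` steps. This bounds loops
over phases by `T` and keeps the `K + 2` real cells of a query clear of the stored capacities. -/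
theorem K_le_T (𝒱 : RMOwP) : 𝒱.K ≤ 𝒱.T := by
  have h : ∀ i : Fin (𝒱.K + 1), 1 + (i : ℕ) ≤ 𝒱.τ i := by
    intro i
    induction i using Fin.induction with
    | zero => simp [𝒱.τ_zero]
    | succ v ih =>
      have := 𝒱.τ_strictMono (show v.castSucc < v.succ from Fin.castSucc_lt_succ)
      simp only [Fin.val_castSucc, Fin.val_succ] at ih ⊢
      omega
  have := h (Fin.last 𝒱.K)
  rw [𝒱.τ_last, Fin.val_last] at this
  omega

theorem one_le_K (𝒱 : RMOwP) : 1 ≤ 𝒱.K := by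
  obtain ⟨v, -⟩ := 𝒱.exists_inPhase le_rfl 𝒱.one_le_T
  exact Fin.pos v

/-- The read-only memory `β` contains the grid, the capacities and the unit ordering costs. -/
structure Loaded (𝒱 : RMOwP) (β : Mem) : Prop where
  numPhases : β.nat 1 = 𝒱.K
  grid : ∀ i : Fin (𝒱.K + 1), β.nat (i + 2) = 𝒱.τ i
  capacity : ∀ t, 1 ≤ t → t ≤ 𝒱.T → β.real (𝒱.T + t + 3) = 𝒱.V t
  phaseCost : ∀ v : Fin 𝒱.K, β.real (𝒱.T + 𝒱.T + 4 + v) = 𝒱.γ v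

/-- The read-only memory `β` contains moreover the initial demand range and the shifts. -/
structure LoadedDemand (𝒱 : RMOwP) (β : Mem) : Prop extends 𝒱.Loaded β where
  dlo : β.real 0 = 𝒱.dlo
  dhi : β.real 1 = 𝒱.dhi
  shift : ∀ k ≤ 𝒱.T, β.real (k + 3) = 𝒱.shift k

/-- The registers contain the constants `T`, `2 T + K + 4`, `p` and `φ`. -/
structure Regs (𝒱 : RMOwP) (φ : ℝ) (n : ℕ → ℕ) (r : ℕ → ℝ) : Prop where
  numDays : n 0 = 𝒱.T
  base : n 1 = 2 * 𝒱.T + 𝒱.K + 4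
  revenue : r 0 = 𝒱.p
  factor : r 1 = φ

theorem Regs.congr {𝒱 : RMOwP} {φ : ℝ} {n n' : ℕ → ℕ} {r r' : ℕ → ℝ} (h : 𝒱.Regs φ n r)
    {s t : List ℕ} (hn : EqOff s n' n) (hr : EqOff t r' r) (hs : 0 ∉ s ∧ 1 ∉ s)
    (ht : 0 ∉ t ∧ 1 ∉ t) : 𝒱.Regs φ n' r' :=
  ⟨(hn 0 hs.1).trans h.1, (hn 1 hs.2).trans h.2, (hr 0 ht.1).trans h.3, (hr 1 ht.2).trans h.4⟩

section Cells

variable {𝒱 : RMOwP} {β : Mem} {n : ℕ → ℕ} {r : ℕ → ℝ}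

theorem Loaded.capacityCell_eval (h : 𝒱.Loaded β) {j t : ℕ} (h0 : n 0 = 𝒱.T)
    (h1 : n 1 = 2 * 𝒱.T + 𝒱.K + 4) (hj : n j = t) (ht1 : 1 ≤ t) (ht2 : t ≤ 𝒱.T) :
    (capacityCell j).eval (β.withRegs n r) = 𝒱.V t := by
  simp only [capacityCell, RExp.eval, NExp.eval, natVar_eval, h0, hj]
  rw [Mem.withRegs_real_of_lt _ _ _ (by omega), h.capacity t ht1 ht2]

theorem Loaded.phaseCostCell_eval (h : 𝒱.Loaded β) (h0 : n 0 = 𝒱.T)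
    (h1 : n 1 = 2 * 𝒱.T + 𝒱.K + 4) (v : Fin 𝒱.K) (hv : n 3 = v) :
    phaseCostCell.eval (β.withRegs n r) = 𝒱.γ v := by
  simp only [phaseCostCell, RExp.eval, NExp.eval, natVar_eval, h0, hv]
  rw [Mem.withRegs_real_of_lt _ _ _ (by omega), h.phaseCost v]

theorem LoadedDemand.errorCell_eval (h : 𝒱.LoadedDemand β) {j k : ℕ}
    (h1 : n 1 = 2 * 𝒱.T + 𝒱.K + 4) (hj : n j = k) (hk : k ≤ 𝒱.T) :
    (errorCell j).eval (β.withRegs n r) = 𝒱.shift k := by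
  simp only [errorCell, RExp.eval, NExp.eval, natVar_eval, hj]
  rw [Mem.withRegs_real_of_lt _ _ _ (by omega), h.shift k hk]

@[simp] theorem capacityCell_cost (j : ℕ) : (capacityCell j).cost = 18 := rfl
@[simp] theorem errorCell_cost (j : ℕ) : (errorCell j).cost = 10 := rfl
@[simp] theorem phaseCostCell_cost : phaseCostCell.cost = 26 := rfl

end Cells

/-! ### Correctness and running time of the subroutines -/

section Specs

variable {𝒱 : RMOwP} {φ : ℝ} {β : Mem} {n : ℕ → ℕ} {r : ℕ → ℝ}

/-- Extension of a family indexed by the phases by zero. -/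
def extendPhases (𝒱 : RMOwP) (f : Fin 𝒱.K → ℝ) (k : ℕ) : ℝ := if h : k < 𝒱.K then f ⟨k, h⟩ else 0

theorem sum_range_extendPhases (𝒱 : RMOwP) (f : Fin 𝒱.K → ℝ) :
    ∑ k ∈ Finset.range 𝒱.K, 𝒱.extendPhases f k = ∑ v, f v := by
  rw [Finset.sum_range]
  exact Finset.sum_congr rfl fun v _ => dif_pos v.2

/-- The loop evaluates the sum over phases that defines `cost`. Its counter is register `3`, which
therefore cannot hold the day. -/
theorem reaches_costCmd (hβ : 𝒱.Loaded β) (hr : 𝒱.Regs φ n r) {j : ℕ} (hj : j ≠ 3) :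
    Reaches β (costCmd j) n r (250 * 𝒱.T) fun n' r' =>
      r' 5 = 𝒱.cost (n j) ∧ EqOff [3] n' n ∧ EqOff [5] r' r := by
  have hK := 𝒱.K_le_T
  have hT := 𝒱.one_le_T
  refine Reaches.mono_time (Reaches.setReal_seq 0 (by simp [RExp.eval]) <|
    Reaches.setNat_seq 0 (by decide) (by simp [NExp.eval]) <|
    (Reaches.loop (N := 170) (fun k n' r' => n' 3 = k ∧
      r' 5 = ∑ v ∈ Finset.range k, 𝒱.extendPhases
        (fun v => if 𝒱.InPhase v (n j) then 𝒱.γ v else 0) v ∧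
      EqOff [3] n' n ∧ EqOff [5] r' r) 𝒱.K ?_ ?_ ?_).mono le_rfl ?_) ?_
  · exact ⟨by simp, by simp, (EqOff.refl _ _).update (by decide) _,
      (EqOff.refl _ _).update (by decide) _⟩
  · rintro k hk n' r' ⟨h3, h5, hn, hr'⟩
    have hR := hr.congr hn hr' (by decide) (by decide)
    have hj' : n' j = n j := hn j (by simpa using hj)
    have hg1 := hβ.grid (⟨k, hk⟩ : Fin 𝒱.K).castSucc
    have hg2 := hβ.grid (⟨k, hk⟩ : Fin 𝒱.K).succ
    simp only [Fin.val_castSucc, Fin.val_succ] at hg1 hg2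
    have hb : (BExp.both (.natLE (.get (.add (natVar 3) (.lit 2))) (natVar j))
        (.natLE (.add (natVar j) (.lit 1)) (.get (.add (natVar 3) (.lit 3))))).eval
        (β.withRegs n' r') ↔ 𝒱.InPhase ⟨k, hk⟩ (n j) := by
      simp only [BExp.eval, NExp.eval, natVar_eval, h3, hj']
      rw [Mem.withRegs_nat_of_lt _ _ _ (by rw [hβ.numPhases]; omega),
        Mem.withRegs_nat_of_lt _ _ _ (by rw [hβ.numPhases]; omega), hg1,
        show k + 3 = k + 1 + 2 by omega, hg2]
      rfl
    refine ⟨?_, Reaches.mono_time (Reaches.seq (N₂ := 16) (Q' := fun n'' r'' => n'' = n' ∧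
      r'' 5 = ∑ v ∈ Finset.range (k + 1), 𝒱.extendPhases
        (fun v => if 𝒱.InPhase v (n j) then 𝒱.γ v else 0) v ∧ EqOff [5] r'' r)
        (Reaches.ite (fun h => Reaches.setReal (v := r' 5 + 𝒱.γ ⟨k, hk⟩) ?_ ?_)
          fun h => Reaches.skip ?_) ?_) ?_⟩
    · simp only [BExp.eval, NExp.eval, natVar_eval, h3, Mem.withRegs_nat_one, hβ.numPhases]
      exact hk
    · rw [RExp.eval, realVar_eval, hβ.phaseCostCell_eval hR.1 hR.2 ⟨k, hk⟩ h3]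
    · refine ⟨rfl, ?_, hr'.update (by decide) _⟩
      rw [Finset.sum_range_succ, Function.update_self, h5, extendPhases, dif_pos hk,
        if_pos (hb.1 h)]
    · refine ⟨rfl, ?_, hr'⟩
      rw [Finset.sum_range_succ, h5, extendPhases, dif_pos hk, if_neg (fun h' => h (hb.2 h')),
        add_zero]
    · rintro _ r'' ⟨rfl, h5', hr''⟩
      refine Reaches.mono_time (Reaches.setNat (v := k + 1) (by decide)
        (by simp [NExp.eval, h3]) ?_) ?_
      · exact ⟨by simp, h5', hn.update (by decide) _, hr''⟩
      · simp [NExp.cost]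
    · simp [BExp.cost, NExp.cost, RExp.cost]
  · rintro n' r' ⟨h3, -⟩
    simp [BExp.eval, NExp.eval, h3, hβ.numPhases]
  · rintro n' r' ⟨-, h5, h⟩
    rw [sum_range_extendPhases] at h5
    exact ⟨h5, h⟩
  · simp only [BExp.cost, NExp.cost, RExp.cost, natVar_cost]
    omega

/-- Real register `4` carries the capacity of the earlier days, so looking up the cost dominates
each iteration. -/
theorem reaches_hindsightCmd (hβ : 𝒱.Loaded β) (hr : 𝒱.Regs φ n r) :
    Reaches β hindsightCmd n r (600 * 𝒱.T ^ 2) fun n' r' =>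
      r' 3 = 𝒱.hindsight (r 2) ∧ EqOff [2, 3] n' n ∧ EqOff [3, 4, 5, 6] r' r := by
  have hT := 𝒱.one_le_T
  refine Reaches.mono_time (Reaches.setReal_seq 0 (by simp [RExp.eval]) <|
    Reaches.setReal_seq 0 (by simp [RExp.eval]) <|
    Reaches.setNat_seq 1 (by decide) (by simp [NExp.eval]) <|
    (Reaches.loop (N := 250 * 𝒱.T + 230) (fun k n' r' => n' 2 = k + 1 ∧
      r' 3 = ∑ t ∈ Finset.Icc 1 k, (𝒱.p - 𝒱.cost t) *
        min (𝒱.V t) (max (r 2 - ∑ i ∈ Finset.Ico 1 t, 𝒱.V i) 0) ∧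
      r' 4 = ∑ i ∈ Finset.Ico 1 (k + 1), 𝒱.V i ∧
      EqOff [2, 3] n' n ∧ EqOff [3, 4, 5, 6] r' r) 𝒱.T ?_ ?_ ?_).mono le_rfl ?_) ?_
  · exact ⟨by simp, by simp, by simp, (EqOff.refl _ _).update (by decide) _,
      ((EqOff.refl _ _).update (by decide) _).update (by decide) _⟩
  · rintro k hk n₁ r₁ ⟨h2, h3, h4, hn₁, hr₁⟩
    have hR₁ := hr.congr hn₁ hr₁ (by decide) (by decide)
    refine ⟨by simp [BExp.eval, h2, hR₁.1]; omega,
      Reaches.mono_time (Reaches.seq (N₂ := 230) (reaches_costCmd hβ hR₁ (by decide)) ?_) ?_⟩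
    · rintro n₂ r₂ ⟨h5, hn₂, hr₂⟩
      have hR := hR₁.congr hn₂ hr₂ (by decide) (by decide)
      have e2 : n₂ 2 = k + 1 := (hn₂ 2 (by decide)).trans h2
      have er2 : r₂ 2 = r 2 := (hr₂ 2 (by decide)).trans (hr₁ 2 (by decide))
      have er3 := (hr₂ 3 (by decide)).trans h3
      have er4 := (hr₂ 4 (by decide)).trans h4
      rw [h2] at h5
      refine Reaches.mono_time (Reaches.setReal_seq (r 2 - r₂ 4) (by simp [RExp.eval, er2]) <|
        Reaches.raiseReal_seq 0 (by simp [RExp.eval]) <|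
        Reaches.lowerReal_seq (𝒱.V (k + 1))
          (hβ.capacityCell_eval hR.1 hR.2 e2 (by omega) hk) <|
        Reaches.setReal_seq (r₂ 3 + (𝒱.p - 𝒱.cost (k + 1)) *
          min (max (r 2 - r₂ 4) 0) (𝒱.V (k + 1)))
          (by simp [RExp.eval, hR.revenue, h5]) <|
        Reaches.setReal_seq (r₂ 4 + 𝒱.V (k + 1)) (by
          rw [RExp.eval, hβ.capacityCell_eval hR.1 hR.2 e2 (by omega) hk]; simp) <|
        Reaches.setNat (v := k + 2) (by decide) (by simp [NExp.eval, e2]) ?_) ?_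
      · refine ⟨by simp, ?_, ?_, ?_, ?_⟩
        · rw [Finset.sum_Icc_succ_top (by omega), ← er3, ← er4]
          simp [min_comm]
        · rw [Finset.sum_Ico_succ_top (by omega), ← er4]
          simp
        · exact (hn₂.trans hn₁ (by decide) (by decide)).update (by decide) _
        · exact ((((((hr₂.trans hr₁ (by decide) (by decide)).update (by decide) _).update
            (by decide) _).update (by decide) _).update (by decide) _).update (by decide) _)
      · simp [NExp.cost, RExp.cost]
    · omega
  · rintro n' r' ⟨h2, -, -, hn, -⟩
    simp [BExp.eval, h2, hn 0 (by decide), hr.1]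
  · rintro n' r' ⟨-, h3, -, hn, hr'⟩
    exact ⟨h3, hn, hr'⟩
  · simp only [BExp.cost, NExp.cost, RExp.cost, natVar_cost]
    nlinarith

theorem reaches_orderCmd (hβ : 𝒱.Loaded β) (hr : 𝒱.Regs φ n r) (h1 : 1 ≤ n 7)
    (h2 : n 7 ≤ 𝒱.T) :
    Reaches β orderCmd n r (1100 * 𝒱.T ^ 2) fun n' r' =>
      r' 12 = 𝒱.safeOrder φ (n 7) (r 2) (r 9) ∧ r' 5 = 𝒱.cost (n 7) ∧ EqOff [2, 3] n' n ∧
      EqOff [3, 4, 5, 6, 12] r' r := by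
  have hT := 𝒱.one_le_T
  refine Reaches.mono_time (Reaches.seq (N₂ := 250 * 𝒱.T + 220)
    (reaches_hindsightCmd hβ hr) ?_) (by nlinarith)
  rintro n₁ r₁ ⟨h3, hn₁, hr₁⟩
  have hR₁ := hr.congr hn₁ hr₁ (by decide) (by decide)
  refine Reaches.mono_time (Reaches.seq (N₂ := 220)
    (reaches_costCmd hβ hR₁ (by decide)) ?_) (by omega)
  rintro n₂ r₂ ⟨h5, hn₂, hr₂⟩
  have hR := hR₁.congr hn₂ hr₂ (by decide) (by decide)
  have e7 := hn₁ 7 (by decide)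
  have e7' := (hn₂ 7 (by decide)).trans e7
  have er2 : r₂ 2 = r 2 := (hr₂ 2 (by decide)).trans (hr₁ 2 (by decide))
  have er9 : r₂ 9 = r 9 := (hr₂ 9 (by decide)).trans (hr₁ 9 (by decide))
  have er3 := (hr₂ 3 (by decide)).trans h3
  rw [e7] at h5
  refine Reaches.mono_time (Reaches.setReal_seq
    ((𝒱.budget φ (r 2) - r 9) / 𝒱.cost (n 7)) (by
      simp [RExp.eval, hR.revenue, hR.factor, er2, er9, er3, h5, budget]) <|
    Reaches.lowerReal_seq (𝒱.V (n 7)) (hβ.capacityCell_eval hR.1 hR.2 e7' h1 h2) <|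
    Reaches.raiseReal (v := 0) (by simp [RExp.eval]) ?_) ?_
  · refine ⟨by simp [safeOrder], by simp [h5], hn₂.trans hn₁ (by decide) (by decide), ?_⟩
    exact ((((hr₂.trans hr₁ (by decide) (by decide)).update (by decide) _).update
      (by decide) _).update (by decide) _)
  · simp [RExp.cost]

/-- The flag is only ever cleared, so successive tests accumulate a conjunction. -/
theorem reaches_passCmd (hβ : 𝒱.LoadedDemand β) (hr : 𝒱.Regs φ n r) :
    Reaches β passCmd n r (2500 * 𝒱.T ^ 3) fun n' r' =>
      (n' 4 = 1 ↔ n 4 = 1 ∧ 𝒱.Passes φ (r 8)) ∧ EqOff [2, 3, 4, 7] n' n ∧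
      EqOff [2, 3, 4, 5, 6, 9, 10, 12] r' r := by
  have hT := 𝒱.one_le_T
  refine Reaches.mono_time (Reaches.setReal_seq 0 (by simp [RExp.eval]) <|
    Reaches.setReal_seq 0 (by simp [RExp.eval]) <|
    Reaches.setNat_seq 1 (by decide) (by simp [NExp.eval]) <|
    Reaches.seq (N₂ := 600 * 𝒱.T ^ 2 + 100)
      (Reaches.loop (N := 1100 * 𝒱.T ^ 2 + 230) (fun k n' r' => n' 7 = k + 1 ∧
      r' 9 = 𝒱.greedySpend φ (𝒱.worstPath (r 8)) k ∧
      r' 10 = 𝒱.greedyGain φ (𝒱.worstPath (r 8)) k ∧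
      EqOff [2, 3, 7] n' n ∧ EqOff [2, 3, 4, 5, 6, 9, 10, 12] r' r) 𝒱.T ?_ ?_ ?_) ?_) ?_
  · exact ⟨by simp, by simp [greedySpend], by simp [greedyGain],
      (EqOff.refl _ _).update (by decide) _,
      ((EqOff.refl _ _).update (by decide) _).update (by decide) _⟩
  · rintro k hk n₁ r₁ ⟨h7, h9, h10, hn₁, hr₁⟩
    have hR₁ := hr.congr hn₁ hr₁ (by decide) (by decide)
    have hR₂ := hR₁.congr (EqOff.refl [] n₁) (((EqOff.refl [2] r₁).update (i := 2) (by decide)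
      (r 8 - 𝒱.Δ (k + 1))).update (i := 2) (by decide)
      (max (r 8 - 𝒱.Δ (k + 1)) 𝒱.dlo)) (by decide) (by decide)
    have e8 : r₁ 8 = r 8 := hr₁ 8 (by decide)
    refine ⟨by simp [BExp.eval, h7, hR₁.1]; omega,
      Reaches.mono_time (Reaches.setReal_seq (r 8 - 𝒱.Δ (k + 1)) (by
        rw [RExp.eval, hβ.errorCell_eval hR₁.2 h7 (by omega), realVar_eval, e8, shift,
          if_neg (by omega)]) <|
      Reaches.raiseReal_seq 𝒱.dlo (by
        simp only [RExp.eval, NExp.eval]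
        rw [Mem.withRegs_real_of_lt _ _ _ (by rw [hR₁.2]; omega), hβ.dlo]) <|
      Reaches.seq (N₂ := 120) (reaches_orderCmd hβ.toLoaded (n := n₁) (φ := φ) (by
        simpa using hR₂) (by omega) (by omega)) ?_) ?_⟩
    · rintro n₂ r₂ ⟨h12, h5, hn₂, hr₂⟩
      have e7 : n₂ 7 = k + 1 := (hn₂ 7 (by decide)).trans h7
      have er0 : r₂ 0 = 𝒱.p := (hr₂ 0 (by decide)).trans (by simpa using hR₁.3)
      have er9 : r₂ 9 = 𝒱.greedySpend φ (𝒱.worstPath (r 8)) k :=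
        (hr₂ 9 (by decide)).trans (by simpa using h9)
      have er10 : r₂ 10 = 𝒱.greedyGain φ (𝒱.worstPath (r 8)) k :=
        (hr₂ 10 (by decide)).trans (by simpa using h10)
      simp [h7, h9] at h12
      rw [h7] at h5
      have hupd := hr₂.trans (((EqOff.refl [2] r₁).update (i := 2) (by decide) _).update
        (i := 2) (by decide) _) (u := [2, 3, 4, 5, 6, 12]) (by decide) (by decide)
      refine Reaches.mono_time (Reaches.setReal_seq
        (𝒱.greedySpend φ (𝒱.worstPath (r 8)) (k + 1)) (by
          simp [RExp.eval, er9, h5, h12, greedySpend, worstPath]) <|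
        Reaches.setReal_seq (𝒱.greedyGain φ (𝒱.worstPath (r 8)) (k + 1)) (by
          simp [RExp.eval, er10, er0, h5, h12, greedyGain, worstPath]) <|
        Reaches.setNat (v := k + 2) (by decide) (by simp [NExp.eval, e7]) ?_) ?_
      · exact ⟨by simp, by simp, by simp,
          (hn₂.trans hn₁ (by decide) (by decide)).update (by decide) _,
          ((hupd.trans hr₁ (by decide) (by decide)).update (by decide) _).update (by decide) _⟩
      · simp [NExp.cost, RExp.cost]
    · simp [NExp.cost, RExp.cost]
      omega
  · rintro n' r' ⟨h7, -, -, hn, -⟩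
    simp [BExp.eval, h7, hn 0 (by decide), hr.1]
  · rintro n₁ r₁ ⟨-, -, h10, hn₁, hr₁⟩
    have hR₁ := hr.congr hn₁ hr₁ (by decide) (by decide)
    have hR₂ := hR₁.congr (EqOff.refl [] n₁) ((EqOff.refl [2] r₁).update (i := 2) (by decide)
      (r 8)) (by decide) (by decide)
    refine Reaches.mono_time (Reaches.setReal_seq (r 8) (by
      simpa using hr₁ 8 (by decide)) <|
      Reaches.seq (N₂ := 60) (reaches_hindsightCmd hβ.toLoaded hR₂) ?_) ?_
    · rintro n₂ r₂ ⟨h3, hn₂, hr₂⟩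
      have hR := hR₂.congr hn₂ hr₂ (by decide) (by decide)
      have e10 := (hr₂ 10 (by decide)).trans ((Function.update_of_ne (by decide) _ _).trans h10)
      rw [Function.update_self] at h3
      have hupd := hr₂.trans ((EqOff.refl [2] r₁).update (i := 2) (by decide) _)
        (u := [2, 3, 4, 5, 6]) (by decide) (by decide)
      have hru := hupd.trans hr₁ (u := [2, 3, 4, 5, 6, 9, 10, 12]) (by decide) (by decide)
      have hnu := hn₂.trans hn₁ (u := [2, 3, 7]) (by decide) (by decide)
      have hb : (BExp.realLE (.mul (realVar 1) (realVar 3)) (realVar 10)).eval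
          (β.withRegs n₂ r₂) ↔ 𝒱.Passes φ (r 8) := by
        simp [BExp.eval, RExp.eval, hR.factor, h3, e10, Passes]
      refine Reaches.mono_time (Reaches.ite (fun h => Reaches.skip ?_)
        fun h => Reaches.setNat (v := 0) (by decide) (by simp [NExp.eval]) ?_) ?_
      · exact ⟨by simp [hnu 4 (by decide), hb.1 h], hnu.mono (by decide), hru⟩
      · refine ⟨?_, (hnu.mono (by decide)).update (by decide) _, hru⟩
        rw [hb] at h
        simp [h]
      · simp [BExp.cost, NExp.cost, RExp.cost]
    · simp
      omega
  · simp only [BExp.cost, NExp.cost, RExp.cost, natVar_cost]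
    have := Nat.pow_le_pow_right hT (show 2 ≤ 3 by omega)
    have := Nat.pow_le_pow_right hT (show 1 ≤ 3 by omega)
    nlinarith [show 𝒱.T * 𝒱.T ^ 2 = 𝒱.T ^ 3 by ring]

theorem reaches_shiftsCmd (hβ : 𝒱.LoadedDemand β) (hr : 𝒱.Regs φ n r) :
    Reaches β shiftsCmd n r (6000 * 𝒱.T ^ 4) fun n' r' =>
      (n' 4 = 1 ↔ n 4 = 1 ∧ ∀ k ≤ 𝒱.T, 𝒱.Passes φ (𝒱.clamp (r 7 + 𝒱.shift k))) ∧
      EqOff [2, 3, 4, 6, 7] n' n ∧ EqOff [2, 3, 4, 5, 6, 8, 9, 10, 12] r' r := by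
  have hT := 𝒱.one_le_T
  refine Reaches.mono_time (Reaches.setNat_seq 0 (by decide) (by simp [NExp.eval]) <|
    (Reaches.loop (N := 2500 * 𝒱.T ^ 3 + 200) (fun k n' r' => n' 6 = k ∧
      (n' 4 = 1 ↔ n 4 = 1 ∧ ∀ j < k, 𝒱.Passes φ (𝒱.clamp (r 7 + 𝒱.shift j))) ∧
      EqOff [2, 3, 4, 6, 7] n' n ∧ EqOff [2, 3, 4, 5, 6, 8, 9, 10, 12] r' r)
      (𝒱.T + 1) ?_ ?_ ?_).mono le_rfl ?_) ?_
  · exact ⟨by simp, by simp, (EqOff.refl _ _).update (by decide) _, EqOff.refl _ _⟩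
  · rintro k hk n₁ r₁ ⟨h6, h4, hn₁, hr₁⟩
    have hR₁ := hr.congr hn₁ hr₁ (by decide) (by decide)
    have e7 : r₁ 7 = r 7 := hr₁ 7 (by decide)
    have hupd := (((EqOff.refl [8] r₁).update (i := 8) (by decide)
      (r 7 + 𝒱.shift k)).update (i := 8) (by decide)
      (max (r 7 + 𝒱.shift k) (𝒱.dlo + 𝒱.Δ 𝒱.T))).update (i := 8) (by decide)
      (min (max (r 7 + 𝒱.shift k) (𝒱.dlo + 𝒱.Δ 𝒱.T)) 𝒱.dhi)
    have hR₂ := hR₁.congr (EqOff.refl [] n₁) hupd (by decide) (by decide)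
    have hΔ := hβ.shift 𝒱.T le_rfl
    rw [shift, if_neg (by omega)] at hΔ
    refine ⟨by simp [BExp.eval, h6, hR₁.1]; omega,
      Reaches.mono_time (Reaches.setReal_seq (r 7 + 𝒱.shift k) (by
        rw [RExp.eval, hβ.errorCell_eval hR₁.2 h6 (by omega), realVar_eval, e7]) <|
      Reaches.raiseReal_seq (𝒱.dlo + 𝒱.Δ 𝒱.T) (by
        simp only [RExp.eval, NExp.eval, natVar_eval, hR₁.1]
        rw [Mem.withRegs_real_of_lt _ _ _ (by rw [hR₁.2]; omega),
          Mem.withRegs_real_of_lt _ _ _ (by rw [hR₁.2]; omega), hβ.dlo, hΔ]) <|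
      Reaches.lowerReal_seq 𝒱.dhi (by
        simp only [RExp.eval, NExp.eval]
        rw [Mem.withRegs_real_of_lt _ _ _ (by rw [hR₁.2]; omega), hβ.dhi]) <|
      Reaches.seq (N₂ := 16) (reaches_passCmd hβ (n := n₁) (φ := φ) (by
        simpa using hR₂)) ?_) ?_⟩
    · rintro n₂ r₂ ⟨h4', hn₂, hr₂⟩
      refine Reaches.mono_time (Reaches.setNat (v := k + 1) (by decide)
        (by simp [NExp.eval, hn₂ 6 (by decide), h6]) ?_) (by simp [NExp.cost])
      refine ⟨by simp, ?_, (hn₂.trans hn₁ (by decide) (by decide)).update (by decide) _, ?_⟩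
      · rw [Function.update_of_ne (by decide), h4', h4, and_assoc]
        simp [clamp, Nat.forall_lt_succ_right, -Order.lt_add_one_iff]
      · refine EqOff.trans (hr₂.trans ?_ (s := [2, 3, 4, 5, 6, 9, 10, 12]) (t := [8])
          (u := [2, 3, 4, 5, 6, 8, 9, 10, 12]) (by decide) (by decide)) hr₁ (by decide) (by decide)
        simpa using hupd
    · simp [NExp.cost, RExp.cost]
      omega
  · rintro n' r' ⟨h6, -, hn, -⟩
    simp [BExp.eval, h6, hn 0 (by decide), hr.1]
  · rintro n' r' ⟨-, h4, h⟩
    exact ⟨by rw [h4]; simp, h⟩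
  · simp only [BExp.cost, NExp.cost, natVar_cost]
    have h1 := Nat.pow_le_pow_right hT (show 3 ≤ 4 by omega)
    have h2 := Nat.pow_le_pow_right hT (show 1 ≤ 4 by omega)
    nlinarith [show 𝒱.T * 𝒱.T ^ 3 = 𝒱.T ^ 4 by ring]

/-- Real register `7` runs through `dhi`, `dlo`, `0 = capacityBefore 1` and then the further partial
sums of the capacities: precisely the finite test `allPass_iff`. -/
theorem reaches_testsCmd (hβ : 𝒱.LoadedDemand β) (hr : 𝒱.Regs φ n r) (hφ : φ ≤ 1) :
    Reaches β testsCmd n r (25000 * 𝒱.T ^ 5) fun n' r' =>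
      (n' 4 = 1 ↔ 𝒱.AllPass φ) ∧ 𝒱.Regs φ n' r' := by
  have hT := 𝒱.one_le_T
  have step : ∀ {n : ℕ → ℕ} {r : ℕ → ℝ} (_ : 𝒱.Regs φ n r) (x : ℝ),
      Reaches β shiftsCmd n (Function.update r 7 x) (6000 * 𝒱.T ^ 4) fun n' r' =>
        (n' 4 = 1 ↔ n 4 = 1 ∧ ∀ k ≤ 𝒱.T, 𝒱.Passes φ (𝒱.clamp (x + 𝒱.shift k))) ∧
        r' 7 = x ∧ n' 5 = n 5 ∧ 𝒱.Regs φ n' r' := by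
    intro n r hr x
    have hR := hr.congr (EqOff.refl [] n) ((EqOff.refl [7] r).update (i := 7) (by decide) x)
      (by decide) (by decide)
    refine (reaches_shiftsCmd hβ hR).mono le_rfl ?_
    rintro n' r' ⟨h4, hn, hr'⟩
    rw [Function.update_self] at h4
    exact ⟨h4, by rw [hr' 7 (by decide), Function.update_self], hn 5 (by decide),
      hR.congr hn hr' (by decide) (by decide)⟩
  have hR := hr.congr ((EqOff.refl [4] n).update (i := 4) (by decide) 1) (EqOff.refl [] r)
    (by decide) (by decide)
  refine Reaches.mono_time (Reaches.setNat_seq 1 (by decide) (by simp [NExp.eval]) <|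
    Reaches.setReal_seq 𝒱.dhi (by
      simp only [RExp.eval, NExp.eval]
      rw [Mem.withRegs_real_of_lt _ _ _ (by rw [hR.2]; omega), hβ.dhi]) <|
    Reaches.seq (N₂ := 𝒱.T * (6000 * 𝒱.T ^ 4 + 100) + 12000 * 𝒱.T ^ 4 + 100) (step hR _) ?_) ?_
  · rintro n₁ r₁ ⟨hflag, -, -, hR₁⟩
    rw [Function.update_self] at hflag
    refine Reaches.mono_time (Reaches.setReal_seq 𝒱.dlo (by
        simp only [RExp.eval, NExp.eval]
        rw [Mem.withRegs_real_of_lt _ _ _ (by rw [hR₁.2]; omega), hβ.dlo]) <|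
      Reaches.seq (N₂ := 𝒱.T * (6000 * 𝒱.T ^ 4 + 100) + 6000 * 𝒱.T ^ 4 + 80) (step hR₁ _) ?_) ?_
    · rintro n₂ r₂ ⟨h4', -, -, hR₂⟩
      refine Reaches.mono_time (Reaches.setReal_seq 0 (by simp [RExp.eval]) <|
        Reaches.seq (N₂ := 𝒱.T * (6000 * 𝒱.T ^ 4 + 100) + 60) (step hR₂ _) ?_) ?_
      · rintro n₃ r₃ ⟨h4'', h7, -, hR₃⟩
        refine Reaches.mono_time (Reaches.setNat_seq 1 (by decide) (by simp [NExp.eval]) <|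
          (Reaches.loop (N := 6000 * 𝒱.T ^ 4 + 60) (fun k n' r' => n' 5 = k + 1 ∧
            r' 7 = 𝒱.capacityBefore (k + 1) ∧
            (n' 4 = 1 ↔ n₂ 4 = 1 ∧ ∀ s, 1 ≤ s → s ≤ k + 1 → ∀ j ≤ 𝒱.T,
              𝒱.Passes φ (𝒱.clamp (𝒱.capacityBefore s + 𝒱.shift j))) ∧ 𝒱.Regs φ n' r')
            𝒱.T ?_ ?_ ?_).mono le_rfl ?_) ?_
        · refine ⟨by simp, by rw [h7, capacityBefore_one], ?_,
            hR₃.congr ((EqOff.refl [5] _).update (by decide) _) (EqOff.refl [] _) (by decide)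
              (by decide)⟩
          rw [Function.update_of_ne (by decide), h4'']
          refine and_congr_right fun _ => ⟨fun h s hs1 hs2 => ?_, fun h => ?_⟩
          · obtain rfl : s = 1 := by omega
            rwa [capacityBefore_one]
          · have := h 1 le_rfl le_rfl
            rwa [capacityBefore_one] at this
        · rintro k hk n' r' ⟨h5, h7, h4, hR'⟩
          refine ⟨by simp [BExp.eval, h5, hR'.1]; omega,
            Reaches.mono_time (Reaches.setReal_seq (𝒱.capacityBefore (k + 2)) (by
              rw [RExp.eval, hβ.capacityCell_eval hR'.1 hR'.2 h5 (by omega) hk, realVar_eval, h7,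
                ← 𝒱.capacityBefore_succ (by omega)]) <|
            Reaches.seq (N₂ := 16) (step hR' _) ?_) ?_⟩
          · rintro n'' r'' ⟨h4', h7', h5', hR''⟩
            refine Reaches.mono_time (Reaches.setNat (v := k + 2) (by decide)
              (by simp [NExp.eval, h5', h5]) ?_) (by simp [NExp.cost])
            refine ⟨by simp, h7', ?_, hR''.congr ((EqOff.refl [5] _).update (by decide) _)
              (EqOff.refl [] _) (by decide) (by decide)⟩
            rw [Function.update_of_ne (by decide), h4', h4, and_assoc]
            refine and_congr_right fun _ =>
              ⟨fun h s hs1 hs2 => ?_, fun h => ⟨fun s hs1 hs2 => ?_, ?_⟩⟩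
            · rcases Nat.lt_or_ge (k + 1) s with hs | hs
              · obtain rfl : s = k + 2 := by omega
                exact h.2
              · exact h.1 s hs1 hs
            · exact h s hs1 (by omega)
            · exact h (k + 2) (by omega) le_rfl
          · simp [RExp.cost]
            omega
        · rintro n' r' ⟨h5, -, -, hR'⟩
          simp [BExp.eval, h5, hR'.1]
        · rintro n' r' ⟨-, -, h4, hR'⟩
          refine ⟨?_, hR'⟩
          rw [h4, h4', hflag, 𝒱.allPass_iff hφ]
          simp only [true_and, and_assoc]
        · simp only [BExp.cost, NExp.cost, natVar_cost]
          nlinarith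
      · simp [RExp.cost]
        omega
    · simp [RExp.cost, NExp.cost]
      omega
  · simp only [RExp.cost, NExp.cost]
    have h1 := Nat.pow_le_pow_right hT (show 4 ≤ 5 by omega)
    have h2 := Nat.pow_le_pow_right hT (show 1 ≤ 5 by omega)
    nlinarith [show 𝒱.T * 𝒱.T ^ 4 = 𝒱.T ^ 5 by ring]

theorem reaches_spendCmd (hβ : 𝒱.Loaded β) (hr : 𝒱.Regs φ n r) {x : Fin 𝒱.K → ℝ}
    (hx : ∀ v : Fin 𝒱.K, β.real (v + 2) = x v) :
    Reaches β spendCmd n r (200 * 𝒱.T) fun n' r' =>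
      r' 9 = ∑ v, 𝒱.γ v * x v ∧ EqOff [3] n' n ∧ EqOff [9] r' r := by
  have hK := 𝒱.K_le_T
  have hT := 𝒱.one_le_T
  refine Reaches.mono_time (Reaches.setReal_seq 0 (by simp [RExp.eval]) <|
    Reaches.setNat_seq 0 (by decide) (by simp [NExp.eval]) <|
    (Reaches.loop (N := 100) (fun k n' r' => n' 3 = k ∧
      r' 9 = ∑ v ∈ Finset.range k, 𝒱.extendPhases (fun v => 𝒱.γ v * x v) v ∧
      EqOff [3] n' n ∧ EqOff [9] r' r) 𝒱.K ?_ ?_ ?_).mono le_rfl ?_) ?_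
  · exact ⟨by simp, by simp, (EqOff.refl _ _).update (by decide) _,
      (EqOff.refl _ _).update (by decide) _⟩
  · rintro k hk n' r' ⟨h3, h9, hn, hr'⟩
    have hR := hr.congr hn hr' (by decide) (by decide)
    refine ⟨?_, Reaches.mono_time (Reaches.setReal_seq (r' 9 + 𝒱.γ ⟨k, hk⟩ * x ⟨k, hk⟩) (by
        simp only [RExp.eval, NExp.eval, natVar_eval, realVar_eval, h3]
        rw [hβ.phaseCostCell_eval hR.1 hR.2 ⟨k, hk⟩ h3,
          Mem.withRegs_real_of_lt _ _ _ (by rw [hR.2]; omega), hx ⟨k, hk⟩]) <|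
      Reaches.setNat (v := k + 1) (by decide) (by simp [NExp.eval, h3]) ?_) ?_⟩
    · simp only [BExp.eval, NExp.eval, natVar_eval, h3, Mem.withRegs_nat_one, hβ.numPhases]
      exact hk
    · refine ⟨by simp, ?_, hn.update (by decide) _, hr'.update (by decide) _⟩
      rw [Finset.sum_range_succ, Function.update_self, h9]
      simp only [extendPhases, dif_pos hk]
    · simp [NExp.cost, RExp.cost]
  · rintro n' r' ⟨h3, -⟩
    simp [BExp.eval, NExp.eval, h3, hβ.numPhases]
  · rintro n' r' ⟨-, h9, h⟩
    rw [sum_range_extendPhases] at h9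
    exact ⟨h9, h⟩
  · simp only [BExp.cost, NExp.cost, RExp.cost, natVar_cost]
    omega

end Specs

end RMOwP

/-! ### The two complete programs -/

namespace RealRAM

/-- Set up the registers. -/
def initCmd : Cmd :=
  .seq (.natSet (natReg 0) (.get (.lit 0)))
    (.natSet (natReg 1) (.add (.add (.add (natVar 0) (natVar 0)) (.get (.lit 1))) (.lit 4)))

/-- Copy the constants `p` and `max Φ 0` into registers. -/
def constantsCmd : Cmd :=
  .seq (setReal 0 (.get (.lit 2))) <| .seq (setReal 1 (.get (.lit 3))) <| raiseReal 1 (.lit 0)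

/-- The program that decides whether a robust competitive ratio is attainable. -/
def decider : Cmd :=
  .seq initCmd <| .seq constantsCmd <| .seq (.realSet (.lit 3) (.lit 0)) <|
  .seq testsCmd <| .natSet (.lit 0) (natVar 4)

/-- The part of the online program that works on registers. -/
def onlineOrderCmd : Cmd :=
  .seq (setNat 7 (.get (.lit 0))) <| .seq spendCmd <| .seq (setReal 2 (.get (.lit 0))) orderCmd

/-- The program that computes the safe order of a day. -/
def online : Cmd := .seq onlineOrderCmd (.realSet (.lit 0) (realVar 12))

theorem Mem.withRegs_update_base_real (β : Mem) (n : ℕ → ℕ) (r : ℕ → ℝ) {j : ℕ} (hj : j < n 1)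
    (v : ℝ) :
    (⟨(β.withRegs n r).nat, Function.update (β.withRegs n r).real j v⟩ : Mem) =
      (⟨β.nat, Function.update β.real j v⟩ : Mem).withRegs n r := by
  simp only [withRegs, Mem.mk.injEq, true_and]
  funext i
  by_cases h : i = j
  · subst h
    simp [hj]
  · rw [Function.update_of_ne h, Function.update_of_ne h]

end RealRAM

/-! ### Input layout and execution of the two programs -/

namespace RMOwP

open RealRAM

section Encode

variable (𝒱 : RMOwP) (Φ : ℝ)

theorem encode_nat_zero : (𝒱.encode Φ).nat 0 = 𝒱.T := rfl

theorem encode_nat_one : (𝒱.encode Φ).nat 1 = 𝒱.K := rfl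

theorem encode_nat_grid (i : Fin (𝒱.K + 1)) : (𝒱.encode Φ).nat (i + 2) = 𝒱.τ i := by
  simp only [encode]
  rw [if_neg (by omega), if_neg (by omega), dif_pos (by omega)]
  rfl

theorem encode_real_error {k : ℕ} (h1 : 1 ≤ k) (h2 : k ≤ 𝒱.T) :
    (𝒱.encode Φ).real (k + 3) = 𝒱.Δ k := by
  simp only [encode]
  rw [if_neg (by omega), if_neg (by omega), if_neg (by omega), if_neg (by omega),
    if_pos (by omega), Nat.add_sub_cancel]

theorem encode_real_capacity {t : ℕ} (h1 : 1 ≤ t) (h2 : t ≤ 𝒱.T) :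
    (𝒱.encode Φ).real (𝒱.T + t + 3) = 𝒱.V t := by
  simp only [encode]
  rw [if_neg (by omega), if_neg (by omega), if_neg (by omega), if_neg (by omega),
    if_neg (by omega), if_pos (by omega)]
  congr 1
  omega

theorem encode_real_phaseCost (v : Fin 𝒱.K) :
    (𝒱.encode Φ).real (𝒱.T + 𝒱.T + 4 + v) = 𝒱.γ v := by
  simp only [encode]
  rw [if_neg (by omega), if_neg (by omega), if_neg (by omega), if_neg (by omega),
    if_neg (by omega), if_neg (by omega), dif_pos (by omega)]
  congr 1
  apply Fin.ext
  simp only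
  omega

end Encode

/-- Executed by hand, since the register rules presuppose that the base address of the real
registers is already in place. The bases `K + 3` and `2 T + K + 4` are the first cells beyond the
input. -/
theorem exec_initCmd (𝒱 : RMOwP) (Φ : ℝ) : ∃ n r,
    Exec initCmd (𝒱.encode Φ)
      ((⟨(Function.update (Function.update (𝒱.encode Φ).nat (𝒱.K + 3) 𝒱.T)
        (𝒱.K + 4) (2 * 𝒱.T + 𝒱.K + 4)), (𝒱.encode Φ).real⟩ : Mem).withRegs n r) 36 ∧
      n 0 = 𝒱.T ∧ n 1 = 2 * 𝒱.T + 𝒱.K + 4 := by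
  set σ : Mem := ⟨(Function.update (Function.update (𝒱.encode Φ).nat (𝒱.K + 3) 𝒱.T)
        (𝒱.K + 4) (2 * 𝒱.T + 𝒱.K + 4)), (𝒱.encode Φ).real⟩ with hσ
  have h1 : σ.nat 1 = 𝒱.K := by
    rw [hσ]
    simp only
    rw [Function.update_of_ne (by omega), Function.update_of_ne (by omega), encode_nat_one]
  refine ⟨fun i => σ.nat (σ.nat 1 + 3 + i), fun i => σ.real (2 * 𝒱.T + 𝒱.K + 4 + i), ?_, ?_, ?_⟩
  · rw [← σ.eq_withRegs (by rw [h1, hσ]; simp)]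
    have e1 := Exec.natSet (natReg 0) (.get (.lit 0)) (𝒱.encode Φ)
    have e2 := Exec.natSet (natReg 1)
      (.add (.add (.add (natVar 0) (natVar 0)) (.get (.lit 1))) (.lit 4))
      ⟨Function.update (𝒱.encode Φ).nat (𝒱.K + 3) 𝒱.T, (𝒱.encode Φ).real⟩
    have hk : Function.update (𝒱.encode Φ).nat (𝒱.K + 3) 𝒱.T 1 = 𝒱.K := by
      rw [Function.update_of_ne (by omega), encode_nat_one]
    simp only [natReg, natVar, NExp.eval, encode_nat_zero, encode_nat_one, add_zero, hk,
      Function.update_self] at e1 e2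
    have := Exec.seq e1 e2
    rw [← two_mul] at this
    exact this
  · rw [h1, hσ]
    simp only
    rw [Function.update_of_ne (by omega), add_zero, Function.update_self]
  · rw [h1, hσ]
    simp

theorem exec_decider (𝒱 : RMOwP) {Φ : ℝ} (hΦ : Φ ≤ 1) :
    ∃ (β : Mem) (n : ℕ → ℕ) (r : ℕ → ℝ) (m : ℕ), Exec decider (𝒱.encode Φ)
      ⟨Function.update (β.withRegs n r).nat 0 (n 4), (β.withRegs n r).real⟩ m ∧
    m ≤ 30000 * 𝒱.T ^ 5 ∧ (n 4 = 1 ↔ 𝒱.AllPass (max Φ 0)) ∧ 𝒱.Loaded β ∧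
    𝒱.Regs (max Φ 0) n r := by
  have hT := 𝒱.one_le_T
  obtain ⟨n₀, r₀, hinit, hn0, hn1⟩ := 𝒱.exec_initCmd Φ
  set β₀ : Mem := ⟨(Function.update (Function.update (𝒱.encode Φ).nat (𝒱.K + 3) 𝒱.T)
        (𝒱.K + 4) (2 * 𝒱.T + 𝒱.K + 4)), (𝒱.encode Φ).real⟩ with hβ₀
  have hnat : ∀ j < 𝒱.K + 3, β₀.nat j = (𝒱.encode Φ).nat j := by
    intro j hj
    rw [hβ₀]
    simp only
    rw [Function.update_of_ne (by omega), Function.update_of_ne (by omega)]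
  have hconst : Reaches β₀ constantsCmd n₀ r₀ 100 fun n' r' => 𝒱.Regs (max Φ 0) n' r' := by
    refine Reaches.mono_time (Reaches.setReal_seq 𝒱.p (by
        simp only [RExp.eval, NExp.eval]
        rw [Mem.withRegs_real_of_lt _ _ _ (by omega)]; rfl) <|
      Reaches.setReal_seq Φ (by
        simp only [RExp.eval, NExp.eval]
        rw [Mem.withRegs_real_of_lt _ _ _ (by omega)]; rfl) <|
      Reaches.raiseReal (v := 0) (by simp [RExp.eval]) ?_) ?_
    · exact ⟨hn0, hn1, by simp, by simp⟩
    · simp [RExp.cost, NExp.cost]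
  obtain ⟨n₁, r₁, m₁, hex₁, hm₁, hR₁⟩ := hconst
  -- Cell `3` held `Φ`, whose truncation `max Φ 0` is now in a register. Clearing it makes cell `k +
  -- 3` contain `shift k` for `k = 0` as well.
  have hset := Exec.realSet (.lit 3) (.lit 0) (β₀.withRegs n₁ r₁)
  simp only [NExp.eval, RExp.eval, Rat.cast_zero] at hset
  rw [Mem.withRegs_update_base_real _ _ _ (by rw [hR₁.2]; omega)] at hset
  set β : Mem := ⟨β₀.nat, Function.update β₀.real 3 0⟩ with hβ
  have hreal : ∀ j, j ≠ 3 → β.real j = (𝒱.encode Φ).real j := fun j hj =>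
    Function.update_of_ne hj _ _
  have hload : 𝒱.LoadedDemand β :=
    { numPhases := hnat 1 (by omega)
      grid := fun i => (hnat _ (by omega)).trans (𝒱.encode_nat_grid Φ i)
      capacity := fun t h1 h2 => (hreal _ (by omega)).trans (𝒱.encode_real_capacity Φ h1 h2)
      phaseCost := fun v => (hreal _ (by omega)).trans (𝒱.encode_real_phaseCost Φ v)
      dlo := hreal 0 (by omega)
      dhi := hreal 1 (by omega)
      shift := fun k hk => by
        rcases Nat.eq_zero_or_pos k with rfl | hk'
        · rw [shift, if_pos rfl]
          exact Function.update_self 3 (0 : ℝ) β₀.real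
        · rw [shift, if_neg (by omega)]
          exact (hreal _ (by omega)).trans (𝒱.encode_real_error Φ hk' hk) }
  obtain ⟨n₂, r₂, m₂, hex₂, hm₂, hflag, hR₂⟩ :=
    reaches_testsCmd hload hR₁ (max_le hΦ zero_le_one)
  have hout := Exec.natSet (.lit 0) (natVar 4) (β.withRegs n₂ r₂)
  rw [natVar_eval] at hout
  refine ⟨β, n₂, r₂, _, .seq hinit (.seq hex₁ (.seq hset (.seq hex₂ hout))), ?_, hflag,
    hload.toLoaded, hR₂⟩
  have := Nat.one_le_pow 5 _ hT
  simp only [NExp.cost, RExp.cost, natVar_cost]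
  omega

/-- After a query, the read-only memory and the registers are still in place. -/
theorem Loaded.query {𝒱 : RMOwP} {φ : ℝ} {β : Mem} {n : ℕ → ℕ} {r : ℕ → ℝ} (hβ : 𝒱.Loaded β)
    (hr : 𝒱.Regs φ n r) (f t : ℕ) (I : ℝ × ℝ) (x : Fin 𝒱.K → ℝ) :
    ∃ β' n' r',
      (⟨Function.update (β.withRegs n r).nat 0 f, (β.withRegs n r).real⟩ : Mem).query t I x =
        Mem.withRegs β' n' r' ∧ 𝒱.Loaded β' ∧ 𝒱.Regs φ n' r' ∧ β'.nat 0 = t ∧ β'.real 0 = I.1 ∧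
      ∀ v : Fin 𝒱.K, β'.real (v + 2) = x v := by
  have hK := 𝒱.K_le_T
  set q := (⟨Function.update (β.withRegs n r).nat 0 f, (β.withRegs n r).real⟩ : Mem).query t I x
    with hq
  have hnat : ∀ j, j ≠ 0 → q.nat j = (β.withRegs n r).nat j := fun j hj => by
    rw [hq]
    simp only [Mem.query]
    rw [Function.update_of_ne hj, Function.update_of_ne hj]
  -- A query overwrites the real cells below `K + 2`, possibly destroying the demand range and error
  -- bounds. Capacities start at `T + 4` and survive, as do the phase costs and registers; a safe
  -- order needs nothing else.
  have hreal : ∀ j, 𝒱.K + 2 ≤ j → q.real j = (β.withRegs n r).real j := fun j hj => by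
    rw [hq]
    simp only [Mem.query]
    rw [if_neg (by omega), if_neg (by omega), dif_neg (by omega)]
  have h1 : q.nat 1 = 𝒱.K := by
    rw [hnat 1 (by omega), Mem.withRegs_nat_one, hβ.numPhases]
  have hreg : ∀ i, q.nat (q.nat 1 + 3 + i) = n i := fun i => by
    rw [hnat _ (by omega), h1, ← hβ.numPhases, Mem.withRegs_nat_reg]
  refine ⟨q, _, _, q.eq_withRegs ((hreg 1).trans hr.2), ⟨h1, fun i => ?_, fun s hs1 hs2 => ?_,
    fun v => ?_⟩, ⟨(hreg 0).trans hr.1, (hreg 1).trans hr.2, ?_, ?_⟩, ?_, ?_, fun v => ?_⟩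
  · rw [hnat _ (by omega), Mem.withRegs_nat_of_lt _ _ _ (by rw [hβ.numPhases]; omega), hβ.grid i]
  · rw [hreal _ (by omega), Mem.withRegs_real_of_lt _ _ _ (by rw [hr.2]; omega),
      hβ.capacity s hs1 hs2]
  · rw [hreal _ (by omega), Mem.withRegs_real_of_lt _ _ _ (by rw [hr.2]; omega), hβ.phaseCost v]
  · rw [hreal _ (by omega), ← hr.2]
    exact (Mem.withRegs_real_reg β n r 0).trans hr.3
  · rw [hreal _ (by omega), ← hr.2, Mem.withRegs_real_reg, hr.4]
  · rw [hq]
    simp [Mem.query]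
  · rw [hq]
    simp [Mem.query]
  · rw [hq]
    simp [Mem.query]

/-- The greedy policy sees the inventory only through its total cost and the interval only through
its lower end, so one weighted sum and one safe order suffice, for arbitrary `x`. -/
theorem exec_online {𝒱 : RMOwP} {φ : ℝ} {β : Mem} {n : ℕ → ℕ} {r : ℕ → ℝ} (hβ : 𝒱.Loaded β)
    (hr : 𝒱.Regs φ n r) {t : ℕ} (ht1 : 1 ≤ t) (ht2 : t ≤ 𝒱.T) {I : ℝ × ℝ} {x : Fin 𝒱.K → ℝ}
    (h0 : β.nat 0 = t) (hI : β.real 0 = I.1) (hx : ∀ v : Fin 𝒱.K, β.real (v + 2) = x v) :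
    ∃ σ m, Exec online (β.withRegs n r) σ m ∧ m ≤ 2000 * 𝒱.T ^ 2 ∧
      σ.real 0 = 𝒱.greedyPolicy φ t I x := by
  have hT := 𝒱.one_le_T
  have key : Reaches β onlineOrderCmd n r (1500 * 𝒱.T ^ 2) fun _ r' =>
      r' 12 = 𝒱.greedyPolicy φ t I x := by
    have hR := hr.congr ((EqOff.refl [7] n).update (i := 7) (by decide) t) (EqOff.refl [] r)
      (by decide) (by decide)
    refine Reaches.mono_time (Reaches.setNat_seq t (by decide) (by
        simp only [NExp.eval]
        rw [Mem.withRegs_nat_of_lt _ _ _ (by omega), h0]) <|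
      Reaches.seq (N₂ := 1100 * 𝒱.T ^ 2 + 20) (reaches_spendCmd hβ hR hx) ?_) ?_
    · rintro n₁ r₁ ⟨h9, hn₁, hr₁⟩
      have hR₁ := hR.congr hn₁ hr₁ (by decide) (by decide)
      have hR₂ := hR₁.congr (EqOff.refl [] n₁) ((EqOff.refl [2] r₁).update (i := 2) (by decide)
        I.1) (by decide) (by decide)
      have e7 : n₁ 7 = t := (hn₁ 7 (by decide)).trans (Function.update_self _ _ _)
      refine Reaches.mono_time (Reaches.setReal_seq I.1 (by
          simp only [RExp.eval, NExp.eval]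
          rw [Mem.withRegs_real_of_lt _ _ _ (by rw [hR₁.2]; omega), hI]) <|
        (reaches_orderCmd hβ hR₂ (by omega) (by omega)).mono le_rfl ?_) ?_
      · rintro n₂ r₂ ⟨h12, -⟩
        rw [h12, Function.update_self, Function.update_of_ne (by decide), h9, e7, greedyPolicy]
      · simp only [RExp.cost, NExp.cost]
        omega
    · simp only [NExp.cost]
      nlinarith
  obtain ⟨n', r', m, hex, hm, h12⟩ := key
  refine ⟨_, _, .seq hex (Exec.realSet _ _ _), ?_, ?_⟩
  · have := Nat.one_le_pow 2 _ hT
    simp only [NExp.cost, realVar_cost]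
    omega
  · simp only [NExp.eval, Function.update_self, realVar_eval, h12]

end RMOwP

theorem mainTheorem8 :
    ∃ (decider online : RealRAM.Cmd) (C : ℕ), ∀ (𝒱 : RMOwP) (Φ : ℝ),
      StrictMono 𝒱.γ → Φ ≤ 1 →
      ∃ (σ : RealRAM.Mem) (n : ℕ),
        RealRAM.Exec decider (𝒱.encode Φ) σ n ∧
        n ≤ C * 𝒱.T ^ (C * 𝒱.K) ∧
        (σ.nat 0 = 1 ↔ (Φ : EReal) ≤ 𝒱.exactOptRatio) ∧
        (σ.nat 0 = 1 ↔ (Φ : EReal) ≤ 𝒱.optRatio) ∧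
        (σ.nat 0 = 1 →
          ∃ π : 𝒱.Policy, 𝒱.IsFeasible π ∧ (Φ : EReal) ≤ 𝒱.robustRatio π ∧
            ∀ t, 1 ≤ t → t ≤ 𝒱.T →
              ∀ I : ℝ × ℝ, 0 ≤ I.2 - I.1 → I.2 - I.1 ≤ 𝒱.Δ t →
                ∀ x : Fin 𝒱.K → ℝ,
                  ∃ (σ' : RealRAM.Mem) (m : ℕ),
                    RealRAM.Exec online (σ.query t I x) σ' m ∧
                    m ≤ C * 𝒱.T ^ (C * 𝒱.K) ∧
                    σ'.real 0 = π t I x) := by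
  -- The constant is the factor in the running time of the decider; as part of the exponent it only
  -- has to exceed `5`, given `K ≥ 1`.
  refine ⟨RealRAM.decider, RealRAM.online, 30000, fun 𝒱 Φ _ hΦ => ?_⟩
  obtain ⟨β, n, r, m, hex, hm, hflag, hβ, hr⟩ := 𝒱.exec_decider hΦ
  have hpow : ∀ k ≤ 5, 𝒱.T ^ k ≤ 𝒱.T ^ (30000 * 𝒱.K) := fun k hk =>
    Nat.pow_le_pow_right 𝒱.one_le_T (by have := 𝒱.one_le_K; omega)
  refine ⟨_, m, hex, hm.trans (Nat.mul_le_mul_left _ (hpow 5 le_rfl)), ?_⟩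
  simp only [Function.update_self, hflag]
  -- Both equivalences come from one cycle: passing all tests gives `Φ ≤ optRatio ≤ exactOptRatio`,
  -- which in turn gives all tests.
  refine ⟨⟨fun h => (𝒱.le_optRatio_of_allPass hΦ h).trans 𝒱.optRatio_le_exactOptRatio,
    𝒱.allPass_of_le_exactOptRatio hΦ⟩, ⟨𝒱.le_optRatio_of_allPass hΦ,
    fun h => 𝒱.allPass_of_le_exactOptRatio hΦ (h.trans 𝒱.optRatio_le_exactOptRatio)⟩,
    fun h => ⟨𝒱.greedyPolicy (max Φ 0), 𝒱.isFeasible_greedyPolicy _,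
      𝒱.le_robustRatio_greedyPolicy hΦ h, fun t ht1 ht2 I _ _ x => ?_⟩⟩
  obtain ⟨β', n', r', hq, hβ', hr', h0, hI, hx⟩ := hβ.query hr (n 4) t I x
  rw [hq]
  obtain ⟨σ', m', hex', hm', hout⟩ := RMOwP.exec_online hβ' hr' ht1 ht2 h0 hI hx
  refine ⟨σ', m', hex', hm'.trans ?_, hout⟩
  exact Nat.mul_le_mul (by norm_num) (hpow 2 (by norm_num))
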